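/- **Binomial Theorem for Suspension Spectra.** All spaces are compactly generated and weak Hausdorff, and products are taken in that category. A based space is *well-based* if the inclusion of its base point is an $h$-cofibration, i.e. has the (unbased) homotopy extension property. A *prespectrum* $E$ is a sequence of based spaces $E_n$ with based maps $\Sigma E_n \to E_{n+1}$; the suspension spectrum $\Sigma^\infty X$ has $n$-th level $\Sigma^n X$ and identity structure maps. Products and wedges of prespectra are formed levelwise. A map of prespectra is a *stable equivalence* if it induces isomorphisms on $\pi_k(E)=\operatorname{colim}_n \pi_{n+k}(E_n)$ for all $k\in\mathbb Z$, and $E\simeq F$ means that $E$ and $F$ are connected by a finite zigzag of stable equivalences. 1. If $X$ and $Y$ are well-based spaces, then the map $$\Sigma^\infty (X \times Y) \longrightarrow \Sigma^\infty (X \wedge Y) \times \Sigma^\infty X \times \Sigma^\infty Y$$ whose components are induced by the projections $X\times Y\to X\wedge Y$, $X \times Y\to X$ and $X\times Y\to Y$ is a stable equivalence. 2. More generally, for every $n\ge 0$, if $X_1,\dots,X_n$ are well-based spaces, then the map $$\Sigma^\infty \prod_{i=1}^n X_i \longrightarrow \prod_{\emptyset \neq S \subseteq \{1,\dots,n\}}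 \Sigma^\infty \bigwedge_{i \in S} X_i$$ whose $S$-component is induced by the projection $\prod_{i=1}^n X_i\to\prod_{i\in S}X_i\to\bigwedge_{i\in S}X_i$ is a stable equivalence. 3. In particular, for every $n \ge 0$, if $X$ is a well-based space, then $$\Sigma^\infty X^n \simeq \bigvee_{i=1}^n \binom{n}{i}\, \Sigma^\infty X^{\wedge i},$$ where $\binom{n}{i}\, \Sigma^\infty X^{\wedge i}$ stands for the wedge of $\binom ni$ copies of $\Sigma^\infty X^{\wedge i}$. -/

import Mathlib

open Set Topology
open scoped unitInterval

universe u

namespace StableSplitting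

/-! ## Compactly generated weak Hausdorff spaces -/

/-- A space is weak Hausdorff if every continuous image of a compact Hausdorff space in it is
closed. -/
class WeaklyHausdorffSpace (X : Type u) [TopologicalSpace X] : Prop where
  isClosed_range : ∀ (K : Type u) [TopologicalSpace K] [CompactSpace K] [T2Space K] (f : C(K, X)),
    IsClosed (range f)

section WeaklyHausdorff

instance (priority := 100) weaklyHausdorffSpace_of_t2 (X : Type u) [TopologicalSpace X]
    [T2Space X] : WeaklyHausdorffSpace X :=
  ⟨fun _ _ _ _ f => (isCompact_range f.continuous).isClosed⟩

theorem isClosed_point {X : Type u} [TopologicalSpace X] [WeaklyHausdorffSpace X] (x : X) :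
    IsClosed ({x} : Set X) := by
  have h := WeaklyHausdorffSpace.isClosed_range PUnit.{u + 1} (ContinuousMap.const _ x)
  convert h using 1
  ext y
  simp [eq_comm]

theorem isClosedMap_of_compact {X : Type u} [TopologicalSpace X] [WeaklyHausdorffSpace X]
    {K : Type u} [TopologicalSpace K] [CompactSpace K] [T2Space K] (f : C(K, X)) :
    IsClosedMap f := by
  intro C hC
  have : CompactSpace C := isCompact_iff_compactSpace.mp hC.isCompact
  have h := WeaklyHausdorffSpace.isClosed_range C (f.comp ⟨Subtype.val, continuous_subtype_val⟩)
  convert h using 1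
  ext y
  simp

theorem isClosed_eqLocus {X : Type u} [TopologicalSpace X] [WeaklyHausdorffSpace X]
    {K L : Type u} [TopologicalSpace K] [CompactSpace K] [T2Space K]
    [TopologicalSpace L] [CompactSpace L] [T2Space L] (f : C(K, X)) (g : C(L, X)) :
    IsClosed {p : K × L | f p.1 = g p.2} := by
  rw [← isOpen_compl_iff, isOpen_iff_mem_nhds]
  rintro ⟨a, b⟩ hab
  let h : C(K ⊕ L, X) := ⟨Sum.elim f g, f.continuous.sumElim g.continuous⟩
  have hcl : IsClosedMap h := isClosedMap_of_compact h
  have hdis : Disjoint (h ⁻¹' {f a}) (h ⁻¹' {g b}) := by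
    rw [Set.disjoint_left]
    intro x hx hx'
    exact hab (hx.symm.trans hx')
  obtain ⟨U, V, hU, hV, haU, hbV, hUV⟩ := normal_separation
    ((isClosed_point (f a)).preimage h.continuous)
    ((isClosed_point (g b)).preimage h.continuous) hdis
  have hopen : ∀ W : Set (K ⊕ L), IsOpen W → IsOpen (h ⁻¹' (h '' Wᶜ))ᶜ := fun W hW =>
    ((hcl _ hW.isClosed_compl).preimage h.continuous).isOpen_compl
  have hmem : IsOpen {p : K × L | Sum.inl p.1 ∈ (h ⁻¹' (h '' Uᶜ))ᶜ ∧
      Sum.inr p.2 ∈ (h ⁻¹' (h '' Vᶜ))ᶜ} :=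
    ((hopen U hU).preimage (continuous_inl.comp continuous_fst)).inter
      ((hopen V hV).preimage (continuous_inr.comp continuous_snd))
  refine Filter.mem_of_superset (hmem.mem_nhds ⟨?_, ?_⟩) ?_
  · rintro ⟨y, hy, hy'⟩
    exact hy (haU hy')
  · rintro ⟨y, hy, hy'⟩
    exact hy (hbV hy')
  · rintro ⟨k, l⟩ ⟨h1, h2⟩ (heq : f k = g l)
    have hkU : (Sum.inl k : K ⊕ L) ∈ U := by
      by_contra hk
      exact h1 ⟨Sum.inl k, hk, rfl⟩
    have hkV : (Sum.inl k : K ⊕ L) ∈ V := by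
      by_contra hk
      exact h2 ⟨Sum.inl k, hk, heq⟩
    exact Set.disjoint_left.mp hUV hkU hkV

theorem weaklyHausdorffSpace_of_eqLocus {P : Type u} [TopologicalSpace P]
    [CompactlyGeneratedSpace P]
    (h : ∀ (K L : Type u) [TopologicalSpace K] [CompactSpace K] [T2Space K]
      [TopologicalSpace L] [CompactSpace L] [T2Space L] (f : C(K, P)) (g : C(L, P)),
      IsClosed {p : K × L | f p.1 = g p.2}) : WeaklyHausdorffSpace P := by
  refine ⟨fun K _ _ _ f => CompactlyGeneratedSpace.isClosed' fun L _ _ _ g hg => ?_⟩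
  have hc := ((h K L f ⟨g, hg⟩).isCompact.image continuous_snd).isClosed
  convert hc using 1
  ext l
  simp

instance weaklyHausdorffSpace_sigma {ι : Type} (X : ι → Type u) [∀ i, TopologicalSpace (X i)]
    [∀ i, WeaklyHausdorffSpace (X i)] : WeaklyHausdorffSpace (Σ i, X i) := by
  refine ⟨fun K _ _ _ f => isClosed_sigma_iff.2 fun i => ?_⟩
  let C : Set K := f ⁻¹' (range (Sigma.mk i))
  have hC : IsClosed C := isClosed_range_sigmaMk.preimage f.continuous
  have : CompactSpace C := isCompact_iff_compactSpace.mp hC.isCompact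
  choose g hg using fun c : C => c.2
  have hgc : Continuous g := by
    refine (@Topology.IsEmbedding.sigmaMk ι X _ i).continuous_iff.2 ?_
    have : Sigma.mk i ∘ g = fun c : C => f c := funext hg
    rw [this]
    exact f.continuous.comp continuous_subtype_val
  have h := WeaklyHausdorffSpace.isClosed_range C ⟨g, hgc⟩
  convert h using 1
  ext x
  constructor
  · rintro ⟨k, hk⟩
    refine ⟨⟨k, x, hk.symm⟩, ?_⟩
    exact sigma_mk_injective ((hg ⟨k, x, hk.symm⟩).trans hk)
  · rintro ⟨c, rfl⟩
    exact ⟨c, (hg c).symm⟩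

end WeaklyHausdorff

/-- The space `P` with its compactly generated topology (its k-ification). -/
def KSpace (P : Type u) : Type u := P

def KSpace.mk {P : Type u} (p : P) : KSpace P := p

def KSpace.val {P : Type u} (p : KSpace P) : P := p

section KSpace

variable {P : Type u} [TopologicalSpace P]

instance : TopologicalSpace (KSpace P) :=
  TopologicalSpace.compactlyGenerated.{u} P

theorem KSpace.continuous_val : Continuous (KSpace.val : KSpace P → P) :=
  continuous_from_compactlyGenerated.{u} (X := P) (fun p => p) fun _ g => g.continuous

theorem KSpace.continuous_mk_comp_of_compact (S : CompHaus.{u}) (g : C(S, P)) :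
    Continuous (fun s => KSpace.mk (g s)) := by
  let f : (Σ (i : (S : CompHaus.{u}) × C(S, P)), i.fst) → KSpace P :=
    fun x => KSpace.mk (x.1.2 x.2)
  have hf : Continuous f := continuous_coinduced_rng
  exact (continuous_sigma_iff.1 hf) ⟨S, g⟩

theorem KSpace.continuous_mk_comp {Z : Type u} [TopologicalSpace Z] [CompactlyGeneratedSpace Z]
    {f : Z → P} (hf : Continuous f) : Continuous (fun z => KSpace.mk (f z)) :=
  continuous_from_uCompactlyGeneratedSpace.{u} _ fun S g =>
    KSpace.continuous_mk_comp_of_compact S ⟨f ∘ g, hf.comp g.continuous⟩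

instance : CompactlyGeneratedSpace (KSpace P) :=
  uCompactlyGeneratedSpace_of_continuous_maps fun f h =>
    continuous_from_compactlyGenerated.{u} (X := P) f fun S g =>
      h S ⟨fun s => KSpace.mk (g s), KSpace.continuous_mk_comp_of_compact S g⟩

end KSpace

instance kSpace_pi_weaklyHausdorff {ι : Type} (X : ι → Type u) [∀ i, TopologicalSpace (X i)]
    [∀ i, WeaklyHausdorffSpace (X i)] : WeaklyHausdorffSpace (KSpace (∀ i, X i)) := by
  refine weaklyHausdorffSpace_of_eqLocus fun K L _ _ _ _ _ _ f g => ?_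
  have hp : ∀ i, Continuous (fun p : KSpace (∀ i, X i) => p.val i) := fun i =>
    (continuous_apply i).comp KSpace.continuous_val
  have h : {p : K × L | f p.1 = g p.2} = ⋂ i, {p : K × L |
      ((⟨_, hp i⟩ : C(KSpace (∀ i, X i), X i)).comp f) p.1 =
      ((⟨_, hp i⟩ : C(KSpace (∀ i, X i), X i)).comp g) p.2} := by
    ext p
    simp only [mem_ofPred_eq, mem_iInter]
    exact funext_iff (f := (f p.1).val) (g := (g p.2).val)
  rw [h]
  exact isClosed_iInter fun i => isClosed_eqLocus _ _

instance kSpace_prod_weaklyHausdorff (X Y : Type u) [TopologicalSpace X] [TopologicalSpace Y]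
    [WeaklyHausdorffSpace X] [WeaklyHausdorffSpace Y] : WeaklyHausdorffSpace (KSpace (X × Y)) := by
  refine weaklyHausdorffSpace_of_eqLocus fun K L _ _ _ _ _ _ f g => ?_
  let p₁ : C(KSpace (X × Y), X) := ⟨fun p => (KSpace.val p).1, continuous_fst.comp KSpace.continuous_val⟩
  let p₂ : C(KSpace (X × Y), Y) := ⟨fun p => (KSpace.val p).2, continuous_snd.comp KSpace.continuous_val⟩
  have h : {p : K × L | f p.1 = g p.2} = {p : K × L | (p₁.comp f) p.1 = (p₁.comp g) p.2} ∩
      {p : K × L | (p₂.comp f) p.1 = (p₂.comp g) p.2} := by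
    ext p
    exact Prod.ext_iff (x := (f p.1).val) (y := (g p.2).val)
  rw [h]
  exact (isClosed_eqLocus _ _).inter (isClosed_eqLocus _ _)

/-- The ordinary product topology on `X × I` is already compactly generated when `X` is. -/
instance compactlyGeneratedSpace_prod_unitInterval (X : Type u) [TopologicalSpace X]
    [CompactlyGeneratedSpace X] : CompactlyGeneratedSpace (X × I) := by
  refine uCompactlyGeneratedSpace_of_continuous_maps fun {Z} _ f h => ?_
  have hK : ∀ (S : CompHaus.{u}) (g : C(S, X)),
      Continuous (fun p : S × I => f (g p.1, p.2)) := fun S g =>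
    h (CompHaus.of (S × I)) ⟨fun p => (g p.1, p.2), by fun_prop⟩
  have hx : ∀ x : X, Continuous (fun t : I => f (x, t)) := fun x =>
    (hK (CompHaus.of PUnit.{u + 1}) (ContinuousMap.const _ x)).comp
      (continuous_const.prodMk continuous_id : Continuous fun t : I => (PUnit.unit.{u + 1}, t))
  let F : X → C(I, Z) := fun x => ⟨fun t => f (x, t), hx x⟩
  have hF : Continuous F := by
    refine continuous_from_uCompactlyGeneratedSpace.{u} F fun S g => ?_
    exact ((⟨_, hK S g⟩ : C(S × I, Z)).curry).continuous
  exact ContinuousMap.continuous_uncurry_of_continuous ⟨F, hF⟩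

instance weaklyHausdorffSpace_prod_unitInterval (X : Type u) [TopologicalSpace X]
    [CompactlyGeneratedSpace X] [WeaklyHausdorffSpace X] : WeaklyHausdorffSpace (X × I) := by
  refine weaklyHausdorffSpace_of_eqLocus fun K L _ _ _ _ _ _ f g => ?_
  let p₁ : C(X × I, X) := ⟨Prod.fst, continuous_fst⟩
  have h : {p : K × L | f p.1 = g p.2} = {p : K × L | (p₁.comp f) p.1 = (p₁.comp g) p.2} ∩
      {p : K × L | (f p.1).2 = (g p.2).2} := by
    ext p
    exact Prod.ext_iff
  rw [h]
  exact (isClosed_eqLocus _ _).inter (isClosed_eq (by fun_prop) (by fun_prop))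

/-! ## Collapsing a closed subspace to a point -/

/-- The relation on `X` identifying all points of `A` with each other. -/
def collapseSetoid {X : Type u} (A : Set X) : Setoid X where
  r x y := x = y ∨ (x ∈ A ∧ y ∈ A)
  iseqv :=
    { refl := fun _ => Or.inl rfl
      symm := by
        rintro x y (h | ⟨h, h'⟩)
        · exact Or.inl h.symm
        · exact Or.inr ⟨h', h⟩
      trans := by
        rintro x y z (rfl | ⟨h, h'⟩) (rfl | ⟨k, k'⟩)
        · exact Or.inl rfl
        · exact Or.inr ⟨k, k'⟩
        · exact Or.inr ⟨h, h'⟩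
        · exact Or.inr ⟨h, k'⟩ }

/-- The quotient space `X / A`. -/
abbrev Collapse {X : Type u} (A : Set X) : Type u := Quotient (collapseSetoid A)

theorem Collapse.mk_eq_iff {X : Type u} {A : Set X} {x y : X} :
    (Quotient.mk (collapseSetoid A) x = Quotient.mk (collapseSetoid A) y) ↔
      (x = y ∨ (x ∈ A ∧ y ∈ A)) :=
  Quotient.eq (r := collapseSetoid A)

/-- A continuous map to `X / A` that misses the class of `A` lifts continuously to `X`. -/
theorem Collapse.exists_lift {X : Type u} [TopologicalSpace X] {A : Set X} (hA : IsClosed A)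
    {C : Type u} [TopologicalSpace C] (f : C(C, Collapse A))
    (hf : ∀ c, ∀ a ∈ A, f c ≠ Quotient.mk _ a) :
    ∃ g : C(C, X), ∀ c, Quotient.mk _ (g c) = f c := by
  choose g hg using fun c => Quotient.exists_rep (f c)
  have hgA : ∀ c, g c ∉ A := fun c hc => hf c _ hc (hg c).symm
  refine ⟨⟨g, ⟨fun U hU => ?_⟩⟩, hg⟩
  have hq : IsOpen (Quotient.mk (collapseSetoid A) '' (U \ A)) := by
    rw [← isQuotientMap_quotient_mk'.isOpen_preimage]
    convert hU.sdiff hA using 1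
    ext x
    constructor
    · rintro ⟨y, hy, hyx⟩
      rcases Collapse.mk_eq_iff.1 hyx with rfl | h
      · exact hy
      · exact absurd h.1 hy.2
    · exact fun hx => ⟨x, hx, rfl⟩
  convert hq.preimage f.continuous using 1
  ext c
  constructor
  · exact fun hc => ⟨g c, ⟨hc, hgA c⟩, hg c⟩
  · rintro ⟨y, hy, hyc⟩
    rcases Collapse.mk_eq_iff.1 (hyc.trans (hg c).symm) with h | h
    · rw [h] at hy
      exact hy.1
    · exact absurd h.1 hy.2

theorem Collapse.weaklyHausdorffSpace {X : Type u} [TopologicalSpace X]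
    [CompactlyGeneratedSpace X] [WeaklyHausdorffSpace X] {A : Set X} (hA : IsClosed A) :
    WeaklyHausdorffSpace (Collapse A) := by
  refine ⟨fun K _ _ _ f => ?_⟩
  have hq : Continuous (Quotient.mk (collapseSetoid A)) := continuous_quotient_mk'
  rw [← isQuotientMap_quotient_mk'.isClosed_preimage]
  by_cases hf : ∀ c, ∀ a ∈ A, f c ≠ Quotient.mk _ a
  · obtain ⟨g, hg⟩ := Collapse.exists_lift hA f hf
    convert WeaklyHausdorffSpace.isClosed_range K g using 1
    ext x
    constructor
    · rintro ⟨k, hk⟩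
      rcases Collapse.mk_eq_iff.1 ((hg k).trans hk) with h | h
      · exact ⟨k, h⟩
      · exact absurd hk (hf k x h.2)
    · rintro ⟨k, rfl⟩
      exact ⟨k, (hg k).symm⟩
  · push Not at hf
    obtain ⟨k₀, a₀, ha₀, hk₀⟩ := hf
    refine CompactlyGeneratedSpace.isClosed' fun L _ _ _ g hg => ?_
    rw [← isOpen_compl_iff, isOpen_iff_mem_nhds]
    intro l₀ hl₀
    have hl₀A : l₀ ∈ g ⁻¹' Aᶜ := by
      intro hl
      exact hl₀ ⟨k₀, hk₀.trans (Collapse.mk_eq_iff.2 (Or.inr ⟨ha₀, hl⟩))⟩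
    obtain ⟨N, hN, hNc, hNA⟩ := exists_mem_nhds_isClosed_subset
      ((hA.isOpen_compl.preimage hg).mem_nhds hl₀A)
    have : CompactSpace N := isCompact_iff_compactSpace.mp hNc.isCompact
    let gN : C(N, X) := ⟨fun l => g l, hg.comp continuous_subtype_val⟩
    have hD : IsClosed (Quotient.mk (collapseSetoid A) '' range gN) := by
      rw [← isQuotientMap_quotient_mk'.isClosed_preimage]
      convert WeaklyHausdorffSpace.isClosed_range N gN using 1
      ext x
      constructor
      · rintro ⟨_, ⟨l, rfl⟩, hy⟩
        rcases Collapse.mk_eq_iff.1 hy with h | h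
        · exact ⟨l, h⟩
        · exact absurd h.1 (hNA l.2)
      · exact fun hx => ⟨x, hx, rfl⟩
    let C : Set K := f ⁻¹' (Quotient.mk (collapseSetoid A) '' range gN)
    have hC : IsClosed C := hD.preimage f.continuous
    have : CompactSpace C := isCompact_iff_compactSpace.mp hC.isCompact
    let fC : C(C, Collapse A) := f.comp ⟨Subtype.val, continuous_subtype_val⟩
    obtain ⟨h, hh⟩ := Collapse.exists_lift hA fC (by
      rintro ⟨k, _, ⟨l, rfl⟩, hy⟩ a ha hka
      rcases Collapse.mk_eq_iff.1 (hy.trans hka) with h | h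
      · rw [← h] at ha
        exact hNA l.2 ha
      · exact hNA l.2 h.1)
    have hcl : IsClosed (g ⁻¹' range h) := (WeaklyHausdorffSpace.isClosed_range C h).preimage hg
    have hl₀' : l₀ ∈ (g ⁻¹' range h)ᶜ := by
      rintro ⟨c, hc⟩
      exact hl₀ ⟨c, ((hh c).symm.trans (congrArg _ hc) : f c = _)⟩
    filter_upwards [hN, hcl.isOpen_compl.mem_nhds hl₀'] with l hlN hl
    rintro ⟨k, hk⟩
    have hkC : k ∈ C := ⟨g l, ⟨⟨l, hlN⟩, rfl⟩, hk.symm⟩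
    rcases Collapse.mk_eq_iff.1 ((hh ⟨k, hkC⟩).trans hk) with h' | h'
    · exact hl ⟨⟨k, hkC⟩, h'⟩
    · exact hNA hlN h'.2

/-! ## Based spaces -/

/-- A based space: a compactly generated weak Hausdorff space with a chosen base point. -/
structure BasedSpace : Type (u + 1) where
  carrier : Type u
  [top : TopologicalSpace carrier]
  [cg : CompactlyGeneratedSpace carrier]
  [wh : WeaklyHausdorffSpace carrier]
  pt : carrier

instance : CoeSort BasedSpace.{u} (Type u) := ⟨BasedSpace.carrier⟩

attribute [instance] BasedSpace.top BasedSpace.cg BasedSpace.wh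

/-- A based map: a continuous map preserving base points. -/
structure BasedMap (X Y : BasedSpace.{u}) where
  toMap : C(X, Y)
  map_pt : toMap X.pt = Y.pt

instance (X Y : BasedSpace.{u}) : CoeFun (BasedMap X Y) (fun _ => X → Y) := ⟨fun f => f.toMap⟩

def BasedMap.id (X : BasedSpace.{u}) : BasedMap X X := ⟨ContinuousMap.id X, rfl⟩

def BasedMap.comp {X Y Z : BasedSpace.{u}} (g : BasedMap Y Z) (f : BasedMap X Y) :
    BasedMap X Z :=
  ⟨g.toMap.comp f.toMap, (congrArg g f.map_pt).trans g.map_pt⟩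

/-- An `h`-cofibration: a map with the homotopy extension property with respect to all compactly
generated weak Hausdorff spaces. -/
def IsHCofibration {A X : Type u} [TopologicalSpace A] [TopologicalSpace X] (i : C(A, X)) : Prop :=
  ∀ (Z : Type u) [TopologicalSpace Z] [CompactlyGeneratedSpace Z] [WeaklyHausdorffSpace Z]
    (f : C(X, Z)) (h : C(A × I, Z)), (∀ a, h (a, 0) = f (i a)) →
    ∃ H : C(X × I, Z), (∀ x, H (x, 0) = f x) ∧ ∀ a t, H (i a, t) = h (a, t)

/-- A based space is well-based if the inclusion of its base point is an `h`-cofibration. -/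
def BasedSpace.WellBased (X : BasedSpace.{u}) : Prop :=
  IsHCofibration (ContinuousMap.const PUnit.{u + 1} X.pt)

/-- The quotient `X / A` by a closed subspace, based at the class of `A`. -/
def BasedSpace.collapse {X : Type u} [TopologicalSpace X] [CompactlyGeneratedSpace X]
    [WeaklyHausdorffSpace X] (A : Set X) (hA : IsClosed A) (a : X) (_ha : a ∈ A) :
    BasedSpace.{u} where
  carrier := Collapse A
  wh := Collapse.weaklyHausdorffSpace hA
  pt := Quotient.mk _ a

/-- The quotient map `X → X / A`. -/
def BasedSpace.collapseMk {X : Type u} [TopologicalSpace X] [CompactlyGeneratedSpace X]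
    [WeaklyHausdorffSpace X] (A : Set X) (hA : IsClosed A) (a : X) (ha : a ∈ A) :
    C(X, BasedSpace.collapse A hA a ha) :=
  ⟨Quotient.mk (collapseSetoid A), continuous_quotient_mk'⟩

theorem BasedSpace.collapseMk_eq_pt {X : Type u} [TopologicalSpace X] [CompactlyGeneratedSpace X]
    [WeaklyHausdorffSpace X] (A : Set X) (hA : IsClosed A) (a : X) (ha : a ∈ A) {x : X}
    (hx : x ∈ A) : collapseMk A hA a ha x = (collapse A hA a ha).pt :=
  Collapse.mk_eq_iff.2 (Or.inr ⟨hx, ha⟩)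

/-- The based map `X / A → Z` induced by a map `X → Z` sending `A` to the base point. -/
def BasedSpace.collapseDesc {X : Type u} [TopologicalSpace X] [CompactlyGeneratedSpace X]
    [WeaklyHausdorffSpace X] (A : Set X) (hA : IsClosed A) (a : X) (ha : a ∈ A)
    {Z : BasedSpace.{u}} (h : C(X, Z)) (hh : ∀ x ∈ A, h x = Z.pt) :
    BasedMap (BasedSpace.collapse A hA a ha) Z where
  toMap := ⟨Quotient.lift h (by
      rintro x y (rfl | ⟨hx, hy⟩)
      · rfl
      · exact (hh x hx).trans (hh y hy).symm), h.continuous.quotient_lift _⟩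
  map_pt := hh a ha

/-! ### Products -/

/-- The product of a family of based spaces (in compactly generated weak Hausdorff spaces). -/
def BasedSpace.pi {ι : Type} (X : ι → BasedSpace.{u}) : BasedSpace.{u} where
  carrier := KSpace (∀ i, X i)
  pt := KSpace.mk fun i => (X i).pt

def BasedSpace.piProj {ι : Type} (X : ι → BasedSpace.{u}) (i : ι) :
    BasedMap (BasedSpace.pi X) (X i) where
  toMap := ⟨fun x => KSpace.val x i, (continuous_apply i).comp KSpace.continuous_val⟩
  map_pt := rfl

def BasedSpace.piLift {ι : Type} {X : ι → BasedSpace.{u}} {Z : BasedSpace.{u}}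
    (f : ∀ i, BasedMap Z (X i)) : BasedMap Z (BasedSpace.pi X) where
  toMap := ⟨fun z => KSpace.mk fun i => f i z,
    KSpace.continuous_mk_comp (P := ∀ i, X i) (continuous_pi fun i => (f i).toMap.continuous)⟩
  map_pt := funext fun i => (f i).map_pt

/-- The product of two based spaces (in compactly generated weak Hausdorff spaces). -/
def BasedSpace.prod (X Y : BasedSpace.{u}) : BasedSpace.{u} where
  carrier := KSpace (X × Y)
  pt := KSpace.mk (X.pt, Y.pt)

def BasedSpace.prodFst (X Y : BasedSpace.{u}) : BasedMap (X.prod Y) X where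
  toMap := ⟨fun p => (KSpace.val p).1, continuous_fst.comp KSpace.continuous_val⟩
  map_pt := rfl

def BasedSpace.prodSnd (X Y : BasedSpace.{u}) : BasedMap (X.prod Y) Y where
  toMap := ⟨fun p => (KSpace.val p).2, continuous_snd.comp KSpace.continuous_val⟩
  map_pt := rfl

def BasedSpace.prodLift {X Y Z : BasedSpace.{u}} (f : BasedMap Z X) (g : BasedMap Z Y) :
    BasedMap Z (X.prod Y) where
  toMap := ⟨fun z => KSpace.mk (f z, g z),
    KSpace.continuous_mk_comp (P := X × Y) (f.toMap.continuous.prodMk g.toMap.continuous)⟩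
  map_pt := Prod.ext f.map_pt g.map_pt

/-! ### Smash products -/

/-- The points of `∏ᵢ Xᵢ` with some coordinate at the base point. -/
def BasedSpace.fatWedge {ι : Type} (X : ι → BasedSpace.{u}) : Set (BasedSpace.pi X) :=
  {x | ∃ i, BasedSpace.piProj X i x = (X i).pt}

theorem BasedSpace.isClosed_fatWedge {ι : Type} [Finite ι] (X : ι → BasedSpace.{u}) :
    IsClosed (BasedSpace.fatWedge X) := by
  have h : BasedSpace.fatWedge X = ⋃ i, (BasedSpace.piProj X i) ⁻¹' {(X i).pt} := by
    ext x
    simp [fatWedge]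
  rw [h]
  exact isClosed_iUnion_of_finite fun i =>
    (isClosed_point _).preimage (BasedSpace.piProj X i).toMap.continuous

theorem BasedSpace.pt_mem_fatWedge {ι : Type} [Nonempty ι] (X : ι → BasedSpace.{u}) :
    (BasedSpace.pi X).pt ∈ BasedSpace.fatWedge X :=
  ⟨Classical.arbitrary ι, rfl⟩

/-- The smash product `⋀ᵢ Xᵢ` of a finite nonempty family of based spaces. -/
def BasedSpace.smash {ι : Type} [Finite ι] [Nonempty ι] (X : ι → BasedSpace.{u}) :
    BasedSpace.{u} :=
  BasedSpace.collapse (BasedSpace.fatWedge X) (BasedSpace.isClosed_fatWedge X)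
    (BasedSpace.pi X).pt (BasedSpace.pt_mem_fatWedge X)

/-- The quotient map `∏ᵢ Xᵢ → ⋀ᵢ Xᵢ`. -/
def BasedSpace.toSmash {ι : Type} [Finite ι] [Nonempty ι] (X : ι → BasedSpace.{u}) :
    BasedMap (BasedSpace.pi X) (BasedSpace.smash X) where
  toMap := BasedSpace.collapseMk _ _ _ _
  map_pt := rfl

/-- The subset `X ∨ Y` of `X × Y`. -/
def BasedSpace.axes (X Y : BasedSpace.{u}) : Set (X.prod Y) :=
  {p | BasedSpace.prodFst X Y p = X.pt ∨ BasedSpace.prodSnd X Y p = Y.pt}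

theorem BasedSpace.isClosed_axes (X Y : BasedSpace.{u}) : IsClosed (BasedSpace.axes X Y) :=
  ((isClosed_point X.pt).preimage (BasedSpace.prodFst X Y).toMap.continuous).union
    ((isClosed_point Y.pt).preimage (BasedSpace.prodSnd X Y).toMap.continuous)

/-- The smash product `X ∧ Y = (X × Y) / (X ∨ Y)`. -/
def BasedSpace.smash₂ (X Y : BasedSpace.{u}) : BasedSpace.{u} :=
  BasedSpace.collapse (BasedSpace.axes X Y) (BasedSpace.isClosed_axes X Y)
    (X.prod Y).pt (Or.inl rfl)

/-- The quotient map `X × Y → X ∧ Y`. -/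
def BasedSpace.toSmash₂ (X Y : BasedSpace.{u}) : BasedMap (X.prod Y) (X.smash₂ Y) where
  toMap := BasedSpace.collapseMk _ _ _ _
  map_pt := rfl

/-! ### Wedge sums -/

/-- The one-point based space. -/
def BasedSpace.point : BasedSpace.{u} where
  carrier := PUnit.{u + 1}
  pt := PUnit.unit

/-- A family of based spaces together with one extra one-point space. -/
def BasedSpace.addPoint {ι : Type} (X : ι → BasedSpace.{u}) (o : Option ι) : BasedSpace.{u} :=
  o.elim BasedSpace.point X

/-- The set of all base points in the disjoint union of the spaces `Xᵢ` and one more point. -/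
def BasedSpace.basePoints {ι : Type} (X : ι → BasedSpace.{u}) :
    Set (Σ o, BasedSpace.addPoint X o) :=
  {p | p.2 = (BasedSpace.addPoint X p.1).pt}

theorem BasedSpace.isClosed_basePoints {ι : Type} (X : ι → BasedSpace.{u}) :
    IsClosed (BasedSpace.basePoints X) :=
  isClosed_sigma_iff.2 fun o => isClosed_point (BasedSpace.addPoint X o).pt

/-- The wedge sum `⋁ᵢ Xᵢ`: the disjoint union with all base points identified. The extra point
in the disjoint union makes the empty wedge a point, and changes nothing otherwise. -/
def BasedSpace.wedge {ι : Type} (X : ι → BasedSpace.{u}) : BasedSpace.{u} :=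
  BasedSpace.collapse (BasedSpace.basePoints X) (BasedSpace.isClosed_basePoints X)
    ⟨none, (BasedSpace.addPoint X none).pt⟩ rfl

/-- The inclusion of a wedge summand. -/
def BasedSpace.wedgeIncl {ι : Type} (X : ι → BasedSpace.{u}) (i : ι) :
    BasedMap (X i) (BasedSpace.wedge X) where
  toMap := (BasedSpace.collapseMk (BasedSpace.basePoints X) (BasedSpace.isClosed_basePoints X)
    ⟨none, (BasedSpace.addPoint X none).pt⟩ rfl).comp
      ⟨fun x => ⟨some i, x⟩, @continuous_sigmaMk _ (fun o => BasedSpace.addPoint X o) _ (some i)⟩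
  map_pt := BasedSpace.collapseMk_eq_pt _ _ _ _ rfl

/-! ### Reduced suspension -/

/-- The subset `X × {0, 1} ∪ {*} × I` of `X × I`. -/
def BasedSpace.suspSet (X : BasedSpace.{u}) : Set (X × I) :=
  {p | p.1 = X.pt ∨ p.2 = 0 ∨ p.2 = 1}

theorem BasedSpace.isClosed_suspSet (X : BasedSpace.{u}) : IsClosed X.suspSet :=
  ((isClosed_point X.pt).preimage continuous_fst).union
    ((isClosed_singleton.preimage continuous_snd).union
      (isClosed_singleton.preimage continuous_snd))

/-- The reduced suspension `Σ X = X ∧ S¹ = (X × I) / (X × {0, 1} ∪ {*} × I)`. -/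
def BasedSpace.susp (X : BasedSpace.{u}) : BasedSpace.{u} :=
  BasedSpace.collapse X.suspSet X.isClosed_suspSet (X.pt, 0) (Or.inl rfl)

/-- The quotient map `X × I → Σ X`. -/
def BasedSpace.suspMk (X : BasedSpace.{u}) : C(X × I, X.susp) :=
  BasedSpace.collapseMk _ _ _ _

theorem BasedSpace.suspMk_eq_pt (X : BasedSpace.{u}) {p : X × I} (hp : p ∈ X.suspSet) :
    X.suspMk p = X.susp.pt :=
  BasedSpace.collapseMk_eq_pt _ _ _ _ hp

/-- The based map `Σ X → Z` induced by a map `X × I → Z`. -/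
def BasedSpace.suspDesc {X Z : BasedSpace.{u}} (h : C(X × I, Z))
    (hh : ∀ p ∈ X.suspSet, h p = Z.pt) : BasedMap X.susp Z :=
  BasedSpace.collapseDesc _ _ _ _ h hh

/-- The suspension `Σ f` of a based map. -/
def BasedMap.susp {X Y : BasedSpace.{u}} (f : BasedMap X Y) : BasedMap X.susp Y.susp :=
  BasedSpace.suspDesc (Y.suspMk.comp (f.toMap.prodMap (ContinuousMap.id I))) (by
    rintro ⟨x, t⟩ hp
    refine Y.suspMk_eq_pt ?_
    rcases hp with (h : x = X.pt) | h
    · exact Or.inl ((congrArg f h).trans f.map_pt)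
    · exact Or.inr h)

/-- The canonical based map `Σ (⋁ᵢ Xᵢ) → Z` given by based maps `Σ Xᵢ → Z`. -/
def BasedSpace.suspWedgeDesc {ι : Type} {X : ι → BasedSpace.{u}} {Z : BasedSpace.{u}}
    (f : ∀ i, BasedMap (X i).susp Z) : BasedMap (BasedSpace.wedge X).susp Z := by
  let F : (Σ o, BasedSpace.addPoint X o) → I → Z := fun p t =>
    match p with
    | ⟨none, _⟩ => Z.pt
    | ⟨some i, x⟩ => f i ((X i).suspMk (x, t))
  have hF : ∀ p ∈ BasedSpace.basePoints X, ∀ t, F p t = Z.pt := by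
    rintro ⟨_ | i, x⟩ hp t
    · rfl
    · have hx : x = (X i).pt := hp
      change f i ((X i).suspMk (x, t)) = Z.pt
      rw [(X i).suspMk_eq_pt (p := (x, t)) (Or.inl hx)]
      exact (f i).map_pt
  have hFt : ∀ p t, (t = 0 ∨ t = 1) → F p t = Z.pt := by
    rintro ⟨_ | i, x⟩ t ht
    · rfl
    · change f i ((X i).suspMk (x, t)) = Z.pt
      rw [(X i).suspMk_eq_pt (p := (x, t)) (Or.inr ht)]
      exact (f i).map_pt
  have hFc : Continuous fun p : (Σ o, BasedSpace.addPoint X o) × I => F p.1 p.2 := by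
    refine ContinuousMap.continuous_uncurry_of_continuous (X := Σ o, BasedSpace.addPoint X o)
      ⟨fun p => ⟨F p, ?_⟩, ?_⟩
    · obtain ⟨_ | i, x⟩ := p
      · exact continuous_const
      · exact (f i).toMap.continuous.comp ((X i).suspMk.continuous.comp
          (continuous_const.prodMk continuous_id))
    · refine continuous_sigma fun o => ?_
      cases o with
      | none => exact (ContinuousMap.const _ (ContinuousMap.const I Z.pt)).continuous
      | some i => exact (((f i).toMap.comp (X i).suspMk).curry).continuous
  let G : BasedSpace.wedge X → I → Z := fun w t =>
    Quotient.lift (fun p => F p t) (by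
      rintro p q (rfl | ⟨hp, hq⟩)
      · rfl
      · exact (hF p hp t).trans (hF q hq t).symm) w
  have hGc : Continuous fun p : BasedSpace.wedge X × I => G p.1 p.2 :=
    (isQuotientMap_quotient_mk' (s := collapseSetoid (BasedSpace.basePoints X))).continuous_lift_prod_left
      (Z := Z) (Y := I) hFc
  exact BasedSpace.suspDesc ⟨fun p => G p.1 p.2, hGc⟩ (by
    rintro ⟨w, t⟩ hp
    rcases hp with (h : w = _) | (h : t = 0 ∨ t = 1)
    · subst h
      exact hF ⟨none, (BasedSpace.addPoint X none).pt⟩ rfl t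
    · induction w using Quotient.inductionOn with
      | h p => exact hFt p t h)

/-! ## Prespectra -/

/-- A prespectrum: based spaces `Eₙ` with structure maps `Σ Eₙ → Eₙ₊₁`. -/
structure Prespectrum : Type (u + 1) where
  level : ℕ → BasedSpace.{u}
  str : ∀ n, BasedMap (level n).susp (level (n + 1))

/-- A map of prespectra: levelwise based maps compatible with the structure maps. -/
structure Prespectrum.Hom (E F : Prespectrum.{u}) where
  map : ∀ n, BasedMap (E.level n) (F.level n)
  comm : ∀ n x, map (n + 1) (E.str n x) = F.str n ((map n).susp x)

/-- The iterated suspensions `Σⁿ X`. -/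
def BasedSpace.suspIter (X : BasedSpace.{u}) : ℕ → BasedSpace.{u}
  | 0 => X
  | n + 1 => (BasedSpace.suspIter X n).susp

def BasedMap.suspIter {X Y : BasedSpace.{u}} (f : BasedMap X Y) :
    ∀ n, BasedMap (X.suspIter n) (Y.suspIter n)
  | 0 => f
  | n + 1 => (BasedMap.suspIter f n).susp

/-- The suspension spectrum `Σ^∞ X`, with `n`-th level `Σⁿ X` and identity structure maps. -/
def suspensionSpectrum (X : BasedSpace.{u}) : Prespectrum.{u} where
  level n := X.suspIter n
  str n := BasedMap.id (X.suspIter (n + 1))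

/-- The map `Σ^∞ f`. -/
def suspensionSpectrumMap {X Y : BasedSpace.{u}} (f : BasedMap X Y) :
    Prespectrum.Hom (suspensionSpectrum X) (suspensionSpectrum Y) where
  map n := f.suspIter n
  comm _ _ := rfl

/-- The product of a family of prespectra, formed levelwise. -/
def Prespectrum.pi {ι : Type} (E : ι → Prespectrum.{u}) : Prespectrum.{u} where
  level n := BasedSpace.pi fun i => (E i).level n
  str n := BasedSpace.piLift fun i =>
    ((E i).str n).comp (BasedSpace.piProj (fun i => (E i).level n) i).susp

/-- The map to a product of prespectra with given components. -/
def Prespectrum.piLift {ι : Type} {E : ι → Prespectrum.{u}} {F : Prespectrum.{u}}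
    (f : ∀ i, Prespectrum.Hom F (E i)) : Prespectrum.Hom F (Prespectrum.pi E) where
  map n := BasedSpace.piLift fun i => (f i).map n
  comm n x := by
    refine funext fun i => ((f i).comm n x).trans ?_
    induction x using Quotient.inductionOn with
    | h p => rfl

/-- The product of two prespectra, formed levelwise. -/
def Prespectrum.prod (E F : Prespectrum.{u}) : Prespectrum.{u} where
  level n := (E.level n).prod (F.level n)
  str n := BasedSpace.prodLift
    ((E.str n).comp (BasedSpace.prodFst (E.level n) (F.level n)).susp)
    ((F.str n).comp (BasedSpace.prodSnd (E.level n) (F.level n)).susp)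

/-- The map to a product of two prespectra with given components. -/
def Prespectrum.prodLift {E F G : Prespectrum.{u}} (f : Prespectrum.Hom G E)
    (g : Prespectrum.Hom G F) : Prespectrum.Hom G (E.prod F) where
  map n := BasedSpace.prodLift (f.map n) (g.map n)
  comm n x := by
    refine Prod.ext ((f.comm n x).trans ?_) ((g.comm n x).trans ?_) <;>
    · induction x using Quotient.inductionOn with
      | h p => rfl

/-- The wedge sum of a family of prespectra, formed levelwise. -/
def Prespectrum.wedge {ι : Type} (E : ι → Prespectrum.{u}) : Prespectrum.{u} where
  level n := BasedSpace.wedge fun i => (E i).level n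
  str n := BasedSpace.suspWedgeDesc fun i =>
    (BasedSpace.wedgeIncl (fun i => (E i).level (n + 1)) i).comp ((E i).str n)

/-! ## Stable homotopy groups and stable equivalences -/

/-- The map induced by a based map on (cubical representatives of) homotopy groups. -/
def homotopyGroupMap {X Y : BasedSpace.{u}} (f : BasedMap X Y) (m : ℕ) :
    HomotopyGroup.Pi m X X.pt → HomotopyGroup.Pi m Y Y.pt :=
  Quotient.map
    (fun a => (⟨f.toMap.comp a.1, fun y hy => (congrArg f (a.2 y hy)).trans f.map_pt⟩ :
      GenLoop (Fin m) Y Y.pt))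
    (fun _ _ h => h.map fun H => H.compContinuousMap f.toMap)

/-- The map `I^(m+1) → Σ X`, `t ↦ [a (t₀, …, tₘ₋₁), tₘ]`, for `a : I^m → X`. -/
def suspGenLoop (X : BasedSpace.{u}) (m : ℕ) (a : GenLoop (Fin m) X X.pt) :
    GenLoop (Fin (m + 1)) X.susp X.susp.pt :=
  ⟨X.suspMk.comp ⟨fun t => (a.1 (fun i => t i.castSucc), t (Fin.last m)), by fun_prop⟩, by
    rintro t ⟨i, hi⟩
    refine X.suspMk_eq_pt ?_
    induction i using Fin.lastCases with
    | last => exact Or.inr hi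
    | cast i => exact Or.inl (a.2 _ ⟨i, hi⟩)⟩

/-- The suspension map `π_m(X) → π_{m+1}(Σ X)`. -/
def homotopyGroupSusp (X : BasedSpace.{u}) (m : ℕ) :
    HomotopyGroup.Pi m X X.pt → HomotopyGroup.Pi (m + 1) X.susp X.susp.pt :=
  Quotient.map (suspGenLoop X m) (by
    rintro a b ⟨H⟩
    exact ⟨{
      toFun := fun p => X.suspMk (H (p.1, fun i => p.2 i.castSucc), p.2 (Fin.last m))
      continuous_toFun := by fun_prop
      map_zero_left := fun t => by
        rw [H.apply_zero]
        rfl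
      map_one_left := fun t => by
        rw [H.apply_one]
        rfl
      prop' := by
        rintro s t ⟨i, hi⟩
        have hb : (suspGenLoop X m a).1 t = X.susp.pt := (suspGenLoop X m a).2 t ⟨i, hi⟩
        refine Eq.trans ?_ hb.symm
        refine X.suspMk_eq_pt ?_
        induction i using Fin.lastCases with
        | last => exact Or.inr hi
        | cast i =>
          refine Or.inl ?_
          have h1 := H.eq_fst s (x := fun i => t i.castSucc) ⟨i, hi⟩
          exact h1.trans (a.2 _ ⟨i, hi⟩) }⟩)

/-- The stabilization map `π_m(Eₙ) → π_{m+1}(Σ Eₙ) → π_{m+1}(Eₙ₊₁)`. -/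
def Prespectrum.stabilize (E : Prespectrum.{u}) (m n : ℕ)
    (α : HomotopyGroup.Pi m (E.level n) (E.level n).pt) :
    HomotopyGroup.Pi (m + 1) (E.level (n + 1)) (E.level (n + 1)).pt :=
  homotopyGroupMap (E.str n) (m + 1) (homotopyGroupSusp (E.level n) m α)

/-- A representative of an element of `π_k(E)`: an element of `π_m(Eₙ)` with `m - n = k`. -/
structure Prespectrum.StableRep (E : Prespectrum.{u}) (k : ℤ) where
  m : ℕ
  n : ℕ
  degree : (m : ℤ) - n = k
  cls : HomotopyGroup.Pi m (E.level n) (E.level n).pt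

def Prespectrum.StableRep.next {E : Prespectrum.{u}} {k : ℤ} (a : E.StableRep k) :
    E.StableRep k where
  m := a.m + 1
  n := a.n + 1
  degree := by
    have := a.degree
    push_cast
    lia
  cls := E.stabilize a.m a.n a.cls

/-- The stable homotopy group `π_k(E) = colim_n π_{n+k}(Eₙ)`, as the colimit of the underlying
sets. -/
def Prespectrum.StableHomotopy (E : Prespectrum.{u}) (k : ℤ) : Type u :=
  Quot fun a b : E.StableRep k => b = a.next

theorem Prespectrum.Hom.map_stabilize {E F : Prespectrum.{u}} (f : Prespectrum.Hom E F) (m n : ℕ)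
    (α : HomotopyGroup.Pi m (E.level n) (E.level n).pt) :
    homotopyGroupMap (f.map (n + 1)) (m + 1) (E.stabilize m n α) =
      F.stabilize m n (homotopyGroupMap (f.map n) m α) := by
  induction α using Quotient.inductionOn with
  | h a =>
    refine congrArg (Quotient.mk _) (GenLoop.ext _ _ fun t => ?_)
    exact f.comm n _

/-- The map induced on stable homotopy groups by a map of prespectra. -/
def Prespectrum.Hom.stableHomotopyMap {E F : Prespectrum.{u}} (f : Prespectrum.Hom E F) (k : ℤ) :
    E.StableHomotopy k → F.StableHomotopy k :=
  Quot.map (fun a => ⟨a.m, a.n, a.degree, homotopyGroupMap (f.map a.n) a.m a.cls⟩) (by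
    rintro a _ rfl
    simp only [Prespectrum.StableRep.next, f.map_stabilize])

/-- A stable equivalence of prespectra: a map inducing isomorphisms on all stable homotopy
groups `π_k`, `k ∈ ℤ`. -/
def Prespectrum.Hom.IsStableEquivalence {E F : Prespectrum.{u}} (f : Prespectrum.Hom E F) : Prop :=
  ∀ k : ℤ, Function.Bijective (f.stableHomotopyMap k)

/-- `E ≃ F`: the prespectra are connected by a finite zigzag of stable equivalences. -/
def Prespectrum.StablyEquivalent (E F : Prespectrum.{u}) : Prop :=
  Relation.EqvGen (fun E F : Prespectrum.{u} => ∃ f : Prespectrum.Hom E F, f.IsStableEquivalence)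
    E F

/-! ## The splitting maps -/

/-- The map `Σ^∞ (X × Y) → Σ^∞ (X ∧ Y) × Σ^∞ X × Σ^∞ Y` whose components are induced by the
projections. -/
def binarySplitting (X Y : BasedSpace.{u}) :
    Prespectrum.Hom (suspensionSpectrum (X.prod Y))
      ((suspensionSpectrum (X.smash₂ Y)).prod
        ((suspensionSpectrum X).prod (suspensionSpectrum Y))) :=
  Prespectrum.prodLift (suspensionSpectrumMap (X.toSmash₂ Y))
    (Prespectrum.prodLift (suspensionSpectrumMap (X.prodFst Y))
      (suspensionSpectrumMap (X.prodSnd Y)))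

/-- The nonempty subsets of `{1, …, n}`. -/
abbrev NonemptySubset (n : ℕ) : Type := {S : Finset (Fin n) // S.Nonempty}

instance {n : ℕ} (S : NonemptySubset n) : Nonempty S.1 := S.2.to_subtype

/-- The projection `∏ᵢ Xᵢ → ∏_{i ∈ S} Xᵢ → ⋀_{i ∈ S} Xᵢ`. -/
def toSubsetSmash {n : ℕ} (X : Fin n → BasedSpace.{u}) (S : NonemptySubset n) :
    BasedMap (BasedSpace.pi X) (BasedSpace.smash fun i : S.1 => X i) :=
  (BasedSpace.toSmash fun i : S.1 => X i).comp
    (BasedSpace.piLift fun i : S.1 => BasedSpace.piProj X i)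

/-- The map `Σ^∞ ∏ᵢ Xᵢ → ∏_S Σ^∞ ⋀_{i ∈ S} Xᵢ` over nonempty `S ⊆ {1, …, n}` whose components are
induced by the projections. -/
def splitting {n : ℕ} (X : Fin n → BasedSpace.{u}) :
    Prespectrum.Hom (suspensionSpectrum (BasedSpace.pi X))
      (Prespectrum.pi fun S : NonemptySubset n =>
        suspensionSpectrum (BasedSpace.smash fun i : S.1 => X i)) :=
  Prespectrum.piLift fun S => suspensionSpectrumMap (toSubsetSmash X S)

/-- The prespectrum `⋁_{i=1}^n (n choose i) Σ^∞ X^{∧ i}`; here `i` is written as `j + 1` with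
`0 ≤ j < n`. -/
def binomialWedge (X : BasedSpace.{u}) (n : ℕ) : Prespectrum.{u} :=
  Prespectrum.wedge fun p : (Σ j : Fin n, Fin (n.choose (j + 1))) =>
    suspensionSpectrum (BasedSpace.smash fun _ : Fin (p.1 + 1) => X)

end StableSplitting

open StableSplitting

namespace StableSplitting

/-! ## Quotient maps and homotopies -/

/-! Everything rests on one splitting principle. Let `B` be a retract of `X`, with inclusion `i`,
retraction `p` and quotient map `q : X → Q = X / B`, and suppose that a neighbourhood of `B` deforms
into `B`. The suspension coordinate allows loops to be subtracted, which gives a self-map `id - Σ(i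
p)` of `Σ X`. On `Σ B` this map runs along a loop and back, so a homotopy makes it constant there,
and it then factors as `s ∘ Σ q` for some `s : Σ Q → Σ X`. The composite `Σ q ∘ s` is homotopic to
the identity, `Σ p ∘ s` is null homotopic, and every suspended class is the product of its image
under `Σ(i p)` and its image under `s ∘ Σ q` (`IsSplitCollapse.exists_section`). Hence `p` and `q`
are jointly bijective on stable homotopy (`IsSplitCollapse.bijective`). The argument needs neither
excision nor long exact sequences.

For `S ⊆ R`, the principle is applied to the partial smash product `M(S, R)`, the quotient of `∏_{i
∈ R} Xᵢ` by the points with some coordinate in `S` at the base point; for nonempty `S` this is the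
half-smash product of `⋀_S` with the unbased space `∏_{R \ S}`. For `j ∈ R \ S`, setting the `j`-th
coordinate to the base point makes `M(S, R \ {j})` a retract of `M(S, R)`, and collapsing it gives
`M(S ∪ {j}, R)`. Well-basedness supplies the deformation (`IsPartialSmash.exists_isSplitCollapse`).
Induction on the size of `R \ S` ends at the spaces `M(T, T)` with `S ⊆ T ⊆ R`, which are smash
products, or a point if `T` is empty (`IsPartialSmash.bijective`). The case `S = ∅`, `R` everything
is the splitting of the product.

Joint bijectivity of the components becomes a stable equivalence into the levelwise product because
cubes and their homotopies are compact Hausdorff, so that maps from them into a product are families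
of maps (`IsLevelProduct.isStableEquivalence`). For the wedge form, the map from a finite wedge of
prespectra to their product is also a stable equivalence: after one suspension, a class in a wedge
is the product of its projections to the summands (`homotopyGroupSusp_wedge_ext`). -/

theorem isQuotientMap_prod_unitInterval {X Y : Type u} [TopologicalSpace X] [TopologicalSpace Y]
    {f : X → Y} (hf : IsQuotientMap f) :
    IsQuotientMap (fun p : X × I => (f p.1, p.2)) := by
  refine ⟨isCoinducing_iff.2 fun s => ?_, ?_⟩
  swap
  · rintro ⟨y, t⟩
    obtain ⟨x, rfl⟩ := hf.surjective y
    exact ⟨(x, t), rfl⟩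
  · symm
    constructor
    · exact fun h => h.preimage ((hf.continuous.comp continuous_fst).prodMk continuous_snd)
    · intro h
      -- A set is open iff its membership predicate is continuous into the Sierpiński space `Prop`;
      -- such a map descends because `I` is locally compact.
      rw [isOpen_iff_continuous_mem] at h ⊢
      exact hf.continuous_lift_prod_left h

/-- A homotopy defined on the source of a quotient map descends to the target. -/
theorem exists_homotopy_desc {X Y Z : Type u} [TopologicalSpace X] [TopologicalSpace Y]
    [TopologicalSpace Z] {f : X → Y} (hf : IsQuotientMap f) (F : C(X × I, Z))
    (h : ∀ x y t, f x = f y → F (x, t) = F (y, t)) :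
    ∃ G : C(Y × I, Z), ∀ x t, G (f x, t) = F (x, t) := by
  have hq := isQuotientMap_prod_unitInterval hf
  have hF : Function.FactorsThrough F (fun p : X × I => (f p.1, p.2)) := by
    rintro ⟨x, t⟩ ⟨y, t'⟩ hxy
    obtain ⟨h1, rfl⟩ := Prod.ext_iff.1 hxy
    exact h _ _ _ h1
  exact ⟨IsQuotientMap.lift (f := ⟨_, hq.continuous⟩) hq F hF, fun x t =>
    DFunLike.congr_fun (IsQuotientMap.lift_comp (f := ⟨_, hq.continuous⟩) hq F hF) (x, t)⟩

/-- A map defined on the source of a quotient map descends to the target. -/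
theorem exists_desc {X Y Z : Type u} [TopologicalSpace X] [TopologicalSpace Y]
    [TopologicalSpace Z] {f : X → Y} (hf : IsQuotientMap f) (F : C(X, Z))
    (h : ∀ x y, f x = f y → F x = F y) :
    ∃ G : C(Y, Z), ∀ x, G (f x) = F x :=
  ⟨IsQuotientMap.lift (f := ⟨f, hf.continuous⟩) hf F fun _ _ hxy => h _ _ hxy, fun x =>
    DFunLike.congr_fun (IsQuotientMap.lift_comp (f := ⟨f, hf.continuous⟩) hf F
      fun _ _ hxy => h _ _ hxy) x⟩

/-- A based map constant on the fibres of a based quotient map descends to the target. -/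
theorem BasedMap.exists_desc {X Y Z : BasedSpace.{u}} (f : BasedMap X Y) (hf : IsQuotientMap f)
    (g : BasedMap X Z) (h : ∀ x y, f x = f y → g x = g y) :
    ∃ k : BasedMap Y Z, ∀ x, k (f x) = g x := by
  obtain ⟨k, hk⟩ := StableSplitting.exists_desc hf g.toMap h
  exact ⟨⟨k, by rw [← f.map_pt]; exact (hk _).trans g.map_pt⟩, hk⟩

theorem BasedMap.ext {X Y : BasedSpace.{u}} {f g : BasedMap X Y} (h : ∀ x, f x = g x) : f = g := by
  obtain ⟨f, hf⟩ := f
  obtain ⟨g, hg⟩ := g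
  obtain rfl : f = g := ContinuousMap.ext h
  rfl

theorem BasedSpace.isQuotientMap_suspMk (X : BasedSpace.{u}) : IsQuotientMap X.suspMk :=
  isQuotientMap_quotient_mk'

theorem BasedSpace.suspMk_eq_iff (X : BasedSpace.{u}) {p q : X × I} :
    X.suspMk p = X.suspMk q ↔ p = q ∨ (p ∈ X.suspSet ∧ q ∈ X.suspSet) :=
  Collapse.mk_eq_iff

theorem BasedSpace.suspMk_pt (X : BasedSpace.{u}) (t : I) : X.suspMk (X.pt, t) = X.susp.pt :=
  X.suspMk_eq_pt (Or.inl rfl)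

theorem BasedSpace.suspMk_zero (X : BasedSpace.{u}) (x : X) : X.suspMk (x, 0) = X.susp.pt :=
  X.suspMk_eq_pt (Or.inr (Or.inl rfl))

theorem BasedSpace.suspMk_one (X : BasedSpace.{u}) (x : X) : X.suspMk (x, 1) = X.susp.pt :=
  X.suspMk_eq_pt (Or.inr (Or.inr rfl))

theorem BasedMap.susp_mk {X Y : BasedSpace.{u}} (f : BasedMap X Y) (x : X) (t : I) :
    f.susp (X.suspMk (x, t)) = Y.suspMk (f x, t) :=
  rfl

/-! ## Induced maps on homotopy groups -/

/-- The image of a generalized loop under a based map. -/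
def genLoopMap {X Y : BasedSpace.{u}} (f : BasedMap X Y) {m : ℕ} (a : GenLoop (Fin m) X X.pt) :
    GenLoop (Fin m) Y Y.pt :=
  ⟨f.toMap.comp a.1, fun y hy => (congrArg f (a.2 y hy)).trans f.map_pt⟩

theorem homotopyGroupMap_comp {X Y Z : BasedSpace.{u}} (g : BasedMap Y Z) (f : BasedMap X Y)
    (m : ℕ) (a : HomotopyGroup.Pi m X X.pt) :
    homotopyGroupMap (g.comp f) m a = homotopyGroupMap g m (homotopyGroupMap f m a) := by
  induction a using Quotient.inductionOn
  rfl

theorem homotopyGroupMap_id (X : BasedSpace.{u}) (m : ℕ) (a : HomotopyGroup.Pi m X X.pt) :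
    homotopyGroupMap (BasedMap.id X) m a = a := by
  induction a using Quotient.inductionOn
  rfl

/-- Based homotopic maps induce the same map on homotopy groups. -/
theorem homotopyGroupMap_congr_of_homotopy {X Y : BasedSpace.{u}} {f g : BasedMap X Y}
    (H : C(X × I, Y)) (h0 : ∀ x, H (x, 0) = f x) (h1 : ∀ x, H (x, 1) = g x)
    (hpt : ∀ t, H (X.pt, t) = Y.pt) (m : ℕ) : homotopyGroupMap f m = homotopyGroupMap g m := by
  funext a
  induction a using Quotient.inductionOn with
  | h a =>
    refine Quotient.sound ⟨{
      toFun := fun p => H (a.1 p.2, p.1)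
      continuous_toFun := by fun_prop
      map_zero_left := fun t => h0 _
      map_one_left := fun t => h1 _
      prop' := fun s t ht => ?_ }⟩
    have ha : a.1 t = X.pt := a.2 t ht
    change H (a.1 t, s) = f (a.1 t)
    rw [ha, hpt, f.map_pt]

theorem homotopyGroupMap_mul {X Y : BasedSpace.{u}} (f : BasedMap X Y) (m : ℕ)
    (a b : HomotopyGroup.Pi (m + 1) X X.pt) :
    homotopyGroupMap f (m + 1) (a * b) =
      homotopyGroupMap f (m + 1) a * homotopyGroupMap f (m + 1) b := by
  induction a using Quotient.inductionOn with
  | h a =>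
  induction b using Quotient.inductionOn with
  | h b =>
    refine (congrArg (homotopyGroupMap f (m + 1))
      (HomotopyGroup.mul_spec (i := 0) (p := a) (q := b))).trans (Eq.trans ?_
      (HomotopyGroup.mul_spec (i := 0) (p := genLoopMap f a) (q := genLoopMap f b)).symm)
    refine congrArg (Quotient.mk _) (GenLoop.ext _ _ fun t => ?_)
    exact apply_ite f _ _ _

theorem homotopyGroupMap_one {X Y : BasedSpace.{u}} (f : BasedMap X Y) (m : ℕ) :
    homotopyGroupMap f (m + 1) 1 = 1 := by
  refine congrArg (Quotient.mk _) (GenLoop.ext _ _ fun t => ?_)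
  exact f.map_pt

theorem homotopyGroupMap_eq_one {X Y : BasedSpace.{u}} {f : BasedMap X Y} (hf : ∀ x, f x = Y.pt)
    (m : ℕ) (a : HomotopyGroup.Pi (m + 1) X X.pt) : homotopyGroupMap f (m + 1) a = 1 := by
  induction a using Quotient.inductionOn with
  | h a => exact congrArg (Quotient.mk _) (GenLoop.ext _ _ fun t => hf _)

theorem homotopyGroupSusp_map {X Y : BasedSpace.{u}} (f : BasedMap X Y) (m : ℕ)
    (a : HomotopyGroup.Pi m X X.pt) :
    homotopyGroupSusp Y m (homotopyGroupMap f m a) =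
      homotopyGroupMap f.susp (m + 1) (homotopyGroupSusp X m a) := by
  induction a using Quotient.inductionOn
  rfl

/-! ## Functoriality of stable homotopy groups -/

def Prespectrum.Hom.comp {E F G : Prespectrum.{u}} (g : Prespectrum.Hom F G)
    (f : Prespectrum.Hom E F) : Prespectrum.Hom E G where
  map n := (g.map n).comp (f.map n)
  comm n x := by
    refine (congrArg (g.map (n + 1)) (f.comm n x)).trans ((g.comm n _).trans ?_)
    induction x using Quotient.inductionOn
    rfl

theorem Prespectrum.Hom.stableHomotopyMap_comp {E F G : Prespectrum.{u}}
    (g : Prespectrum.Hom F G) (f : Prespectrum.Hom E F) (k : ℤ) (α : E.StableHomotopy k) :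
    (g.comp f).stableHomotopyMap k α = g.stableHomotopyMap k (f.stableHomotopyMap k α) := by
  induction α using Quot.inductionOn with
  | h a =>
    refine congrArg (Quot.mk _) ?_
    simp only [Prespectrum.Hom.comp, homotopyGroupMap_comp]

theorem Prespectrum.Hom.ext {E F : Prespectrum.{u}} {f g : Prespectrum.Hom E F}
    (h : ∀ n x, f.map n x = g.map n x) : f = g := by
  obtain ⟨f, hf⟩ := f
  obtain ⟨g, hg⟩ := g
  obtain rfl : f = g := funext fun n => BasedMap.ext (h n)
  rfl

/-! ## A criterion for a family of maps to be jointly bijective on stable homotopy -/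

/-- The class in `π_k(E)` of an element of `π_m(Eₙ)`, `m - n = k`. -/
def Prespectrum.stableClass (E : Prespectrum.{u}) {k : ℤ} {m n : ℕ} (h : (m : ℤ) - n = k)
    (c : HomotopyGroup.Pi m (E.level n) (E.level n).pt) : E.StableHomotopy k :=
  Quot.mk _ ⟨m, n, h, c⟩

/-- The iterated stabilization map `π_m(Eₙ) → π_{m+j}(Eₙ₊ⱼ)`. -/
def Prespectrum.stabilizeIter (E : Prespectrum.{u}) (m n : ℕ)
    (c : HomotopyGroup.Pi m (E.level n) (E.level n).pt) :
    ∀ j : ℕ, HomotopyGroup.Pi (m + j) (E.level (n + j)) (E.level (n + j)).pt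
  | 0 => c
  | j + 1 => E.stabilize (m + j) (n + j) (E.stabilizeIter m n c j)

theorem Prespectrum.stableClass_stabilize (E : Prespectrum.{u}) {k : ℤ} {m n : ℕ}
    (h : (m : ℤ) - n = k) (h' : ((m + 1 : ℕ) : ℤ) - (n + 1 : ℕ) = k)
    (c : HomotopyGroup.Pi m (E.level n) (E.level n).pt) :
    E.stableClass h' (E.stabilize m n c) = E.stableClass h c :=
  (Quot.sound (r := fun a b : E.StableRep k => b = a.next) (a := ⟨m, n, h, c⟩) rfl).symm

theorem Prespectrum.stableClass_stabilizeIter (E : Prespectrum.{u}) {k : ℤ} {m n : ℕ}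
    (h : (m : ℤ) - n = k) (c : HomotopyGroup.Pi m (E.level n) (E.level n).pt) (j : ℕ)
    (h' : ((m + j : ℕ) : ℤ) - (n + j : ℕ) = k) :
    E.stableClass h' (E.stabilizeIter m n c j) = E.stableClass h c := by
  induction j with
  | zero => rfl
  | succ j ih =>
    have h'' : ((m + j : ℕ) : ℤ) - (n + j : ℕ) = k := by push_cast at h' ⊢; lia
    exact (E.stableClass_stabilize h'' h' _).trans (ih h'')

theorem Prespectrum.Hom.stableHomotopyMap_stableClass {E F : Prespectrum.{u}}
    (f : Prespectrum.Hom E F) {k : ℤ} {m n : ℕ} (h : (m : ℤ) - n = k)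
    (c : HomotopyGroup.Pi m (E.level n) (E.level n).pt) :
    f.stableHomotopyMap k (E.stableClass h c) = F.stableClass h (homotopyGroupMap (f.map n) m c) :=
  rfl

theorem Prespectrum.Hom.map_stabilizeIter {E F : Prespectrum.{u}} (f : Prespectrum.Hom E F)
    (m n : ℕ) (c : HomotopyGroup.Pi m (E.level n) (E.level n).pt) (j : ℕ) :
    homotopyGroupMap (f.map (n + j)) (m + j) (E.stabilizeIter m n c j) =
      F.stabilizeIter m n (homotopyGroupMap (f.map n) m c) j := by
  induction j with
  | zero => rfl
  | succ j ih =>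
    refine (f.map_stabilize (m + j) (n + j) _).trans ?_
    rw [ih]
    rfl

theorem Prespectrum.next_iterate (E : Prespectrum.{u}) {k : ℤ} {m n : ℕ} (h : (m : ℤ) - n = k)
    (c : HomotopyGroup.Pi m (E.level n) (E.level n).pt) (j : ℕ)
    (h' : ((m + j : ℕ) : ℤ) - (n + j : ℕ) = k) :
    Prespectrum.StableRep.next^[j] (⟨m, n, h, c⟩ : E.StableRep k) =
      ⟨m + j, n + j, h', E.stabilizeIter m n c j⟩ := by
  induction j with
  | zero => rfl
  | succ j ih =>
    have h'' : ((m + j : ℕ) : ℤ) - (n + j : ℕ) = k := by push_cast at h' ⊢; lia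
    rw [Function.iterate_succ_apply', ih h'']
    rfl

/-- Because `next` is a function, having a common iterate is already an equivalence relation: for
transitivity, iterate further and use that iterates commute. -/
theorem Prespectrum.exists_next_iterate_eq (E : Prespectrum.{u}) {k : ℤ} {a b : E.StableRep k}
    (h : (Quot.mk _ a : E.StableHomotopy k) = Quot.mk _ b) :
    ∃ i j, Prespectrum.StableRep.next^[i] a = Prespectrum.StableRep.next^[j] b := by
  induction Quot.eqvGen_exact h with
  | rel x y hxy => exact ⟨1, 0, hxy.symm⟩
  | refl x => exact ⟨0, 0, rfl⟩
  | symm x y _ ih =>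
    obtain ⟨i, j, hij⟩ := ih (Quot.eqvGen_sound ‹_›)
    exact ⟨j, i, hij.symm⟩
  | trans x y z _ _ ih₁ ih₂ =>
    obtain ⟨i, j, hij⟩ := ih₁ (Quot.eqvGen_sound ‹_›)
    obtain ⟨i', j', hij'⟩ := ih₂ (Quot.eqvGen_sound ‹_›)
    refine ⟨i' + i, j + j', ?_⟩
    rw [Function.iterate_add_apply, hij, ← Function.iterate_add_apply, Nat.add_comm,
      Function.iterate_add_apply, hij', ← Function.iterate_add_apply]

theorem Prespectrum.StableRep.next_iterate_n {E : Prespectrum.{u}} {k : ℤ} (a : E.StableRep k)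
    (j : ℕ) : (Prespectrum.StableRep.next^[j] a).n = a.n + j := by
  induction j with
  | zero => rfl
  | succ j ih =>
    rw [Function.iterate_succ_apply']
    exact congrArg (· + 1) ih

theorem Prespectrum.exists_stabilizeIter_eq (E : Prespectrum.{u}) {k : ℤ} {m n : ℕ}
    (h : (m : ℤ) - n = k) {c c' : HomotopyGroup.Pi m (E.level n) (E.level n).pt}
    (hc : E.stableClass h c = E.stableClass h c') :
    ∃ N, ∀ j, N ≤ j → E.stabilizeIter m n c j = E.stabilizeIter m n c' j := by
  obtain ⟨i, j, hij⟩ := E.exists_next_iterate_eq hc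
  -- Both representatives start at level `n` and each step raises the level by one, so the two
  -- iteration counts are equal.
  have hn := congrArg Prespectrum.StableRep.n hij
  rw [Prespectrum.StableRep.next_iterate_n, Prespectrum.StableRep.next_iterate_n] at hn
  obtain rfl : i = j := Nat.add_left_cancel hn
  have h' : ((m + i : ℕ) : ℤ) - (n + i : ℕ) = k := by push_cast; lia
  rw [E.next_iterate h _ _ h', E.next_iterate h _ _ h'] at hij
  refine ⟨i, fun l hl => ?_⟩
  induction l, hl using Nat.le_induction with
  | base => simpa using hij
  | succ l _ ih => exact congrArg (E.stabilize (m + l) (n + l)) ih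

/-- The bound is uniform over all later levels, so that finitely many classes can be represented at
one common level. -/
theorem Prespectrum.exists_stableClass_eq (E : Prespectrum.{u}) {k : ℤ} (α : E.StableHomotopy k) :
    ∃ N : ℕ, ∀ (m n : ℕ) (h : (m : ℤ) - n = k), N ≤ n → ∃ c, α = E.stableClass h c := by
  induction α using Quot.inductionOn with
  | h a =>
    obtain ⟨m, n, h, c⟩ := a
    refine ⟨n, fun m' n' h' hn => ?_⟩
    obtain ⟨j, rfl⟩ := Nat.exists_eq_add_of_le hn
    obtain rfl : m' = m + j := by push_cast at h'; lia
    exact ⟨_, (E.stableClass_stabilizeIter h c j h').symm⟩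

theorem exists_le_forall {ι : Type} [Finite ι] (f : ι → ℕ) : ∃ N, ∀ i, f i ≤ N := by
  obtain ⟨N, hN⟩ := (Set.finite_range f).bddAbove
  exact ⟨N, fun i => hN ⟨i, rfl⟩⟩

/-- A family of maps of prespectra is jointly bijective on all stable homotopy groups. -/
def JointlyBijective {ι : Type} {E : Prespectrum.{u}} {F : ι → Prespectrum.{u}}
    (p : ∀ i, Prespectrum.Hom E (F i)) : Prop :=
  ∀ k : ℤ, Function.Bijective fun (α : E.StableHomotopy k) i => (p i).stableHomotopyMap k α

/-- A sequential colimit does not notice a delay by one stage, so both conditions may be tested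
after one stabilization. This is what makes group multiplication available: `m` may be zero, but `m
+ 1` is positive. Finiteness of `ι` provides a stage that serves all components at once. -/
theorem jointlyBijective_of_stabilize {ι : Type} [Finite ι] {E : Prespectrum.{u}}
    {F : ι → Prespectrum.{u}} (p : ∀ i, Prespectrum.Hom E (F i))
    (inj : ∀ (m n : ℕ) (c c' : HomotopyGroup.Pi m (E.level n) (E.level n).pt),
      (∀ i, homotopyGroupMap ((p i).map n) m c = homotopyGroupMap ((p i).map n) m c') →
      E.stabilize m n c = E.stabilize m n c')
    (surj : ∀ (m n : ℕ) (b : ∀ i, HomotopyGroup.Pi m ((F i).level n) ((F i).level n).pt),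
      ∃ c : HomotopyGroup.Pi (m + 1) (E.level (n + 1)) (E.level (n + 1)).pt,
        ∀ i, homotopyGroupMap ((p i).map (n + 1)) (m + 1) c = (F i).stabilize m n (b i)) :
    JointlyBijective p := by
  intro k
  constructor
  · intro α β hαβ
    obtain ⟨N, hN⟩ := E.exists_stableClass_eq α
    obtain ⟨N', hN'⟩ := E.exists_stableClass_eq β
    -- Taking `n ≥ |k|` keeps `n + k` nonnegative, so `toNat` does not truncate.
    let n := max (max N N') k.natAbs
    let m := (n + k).toNat
    have h : (m : ℤ) - n = k := by lia
    obtain ⟨c, rfl⟩ := hN m n h (by lia)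
    obtain ⟨c', rfl⟩ := hN' m n h (by lia)
    have hex : ∀ i, ∃ N, ∀ j, N ≤ j →
        (F i).stabilizeIter m n (homotopyGroupMap ((p i).map n) m c) j =
        (F i).stabilizeIter m n (homotopyGroupMap ((p i).map n) m c') j := fun i =>
      (F i).exists_stabilizeIter_eq h (congrFun hαβ i)
    choose M hM using hex
    obtain ⟨j, hj⟩ := exists_le_forall M
    have h' : ((m + j : ℕ) : ℤ) - (n + j : ℕ) = k := by push_cast; lia
    have h'' : ((m + j + 1 : ℕ) : ℤ) - (n + j + 1 : ℕ) = k := by push_cast; lia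
    rw [← E.stableClass_stabilizeIter h c j h', ← E.stableClass_stabilizeIter h c' j h',
      ← E.stableClass_stabilize h' h'', ← E.stableClass_stabilize h' h'']
    refine congrArg _ (inj _ _ _ _ fun i => ?_)
    rw [(p i).map_stabilizeIter, (p i).map_stabilizeIter]
    exact hM i j (hj i)
  · intro β
    choose N hN using fun i => (F i).exists_stableClass_eq (β i)
    obtain ⟨N', hN'⟩ := exists_le_forall N
    let n := max N' k.natAbs
    let m := (n + k).toNat
    have h : (m : ℤ) - n = k := by lia
    have h' : ((m + 1 : ℕ) : ℤ) - (n + 1 : ℕ) = k := by push_cast; lia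
    choose b hb using fun i => hN i m n h ((hN' i).trans (le_max_left _ _))
    obtain ⟨c, hc⟩ := surj m n b
    refine ⟨E.stableClass h' c, funext fun i => ?_⟩
    change (p i).stableHomotopyMap k (E.stableClass h' c) = β i
    rw [(p i).stableHomotopyMap_stableClass, hc, (F i).stableClass_stabilize h h', hb]

/-! ## Levelwise products -/

/-- The maps `G → Eᵢ` exhibit each level of `G` as a product, as far as maps from compact
Hausdorff spaces are concerned. -/
structure IsLevelProduct {ι : Type} {G : Prespectrum.{u}} {E : ι → Prespectrum.{u}}
    (pr : ∀ i, Prespectrum.Hom G (E i)) : Prop where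
  inj : ∀ n x y, (∀ i, (pr i).map n x = (pr i).map n y) → x = y
  lift : ∀ n (T : Type) [TopologicalSpace T] [CompactSpace T] [T2Space T]
    (f : ∀ i, C(T, (E i).level n)), ∃ g : C(T, G.level n), ∀ i t, (pr i).map n (g t) = f i t

/-- Homotopy groups commute with products already at each level: representatives and homotopies are
both lifted componentwise. The stabilization in the surjectivity part only serves to fit the
criterion. -/
theorem IsLevelProduct.jointlyBijective {ι : Type} [Finite ι] {G : Prespectrum.{u}}
    {E : ι → Prespectrum.{u}} {pr : ∀ i, Prespectrum.Hom G (E i)} (h : IsLevelProduct pr) :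
    JointlyBijective pr := by
  refine jointlyBijective_of_stabilize pr (fun m n c c' hc => ?_) fun m n b => ?_
  · refine congrArg _ ?_
    induction c using Quotient.inductionOn with
    | h c =>
    induction c' using Quotient.inductionOn with
    | h c' =>
      have H := fun i => (Quotient.exact (hc i)).some
      obtain ⟨K, hK⟩ := h.lift n (I × (Fin m → I)) fun i => (H i).toContinuousMap
      refine Quotient.sound ⟨{
        toFun := K
        continuous_toFun := K.continuous
        map_zero_left := fun t => h.inj n _ _ fun i => (hK i _).trans ((H i).apply_zero t)
        map_one_left := fun t => h.inj n _ _ fun i => (hK i _).trans ((H i).apply_one t)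
        prop' := fun s t ht => h.inj n _ _ fun i => (hK i _).trans ((H i).eq_fst s ht) }⟩
  · choose f hf using fun i => Quotient.exists_rep (b i)
    obtain ⟨g, hg⟩ := h.lift n (Fin m → I) fun i => (f i).1
    let c : GenLoop (Fin m) (G.level n) (G.level n).pt := ⟨g, fun t ht => h.inj n _ _ fun i =>
      (hg i t).trans (((f i).2 t ht).trans ((pr i).map n).map_pt.symm)⟩
    refine ⟨G.stabilize m n (Quotient.mk _ c), fun i => ?_⟩
    refine ((pr i).map_stabilize m n _).trans ?_
    rw [← hf i]
    exact congrArg ((E i).stabilize m n)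
      (congrArg (Quotient.mk _) (GenLoop.ext _ _ fun t => hg i t))

/-- A map into a levelwise product is a stable equivalence as soon as its components are jointly
bijective on stable homotopy groups. -/
theorem IsLevelProduct.isStableEquivalence {ι : Type} [Finite ι] {G F : Prespectrum.{u}}
    {E : ι → Prespectrum.{u}} {pr : ∀ i, Prespectrum.Hom G (E i)} (h : IsLevelProduct pr)
    (f : Prespectrum.Hom F G) (g : ∀ i, Prespectrum.Hom F (E i)) (hg : JointlyBijective g)
    (hfg : ∀ i n x, (pr i).map n (f.map n x) = (g i).map n x) : f.IsStableEquivalence := by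
  intro k
  obtain rfl : (fun i => (pr i).comp f) = g := funext fun i => Prespectrum.Hom.ext (hfg i)
  refine (Function.Bijective.of_comp_iff' (h.jointlyBijective k) _).1 ?_
  convert hg k using 1
  funext α i
  exact ((pr i).stableHomotopyMap_comp f k α).symm

/-- Passing to the k-ification does not change the maps from compact Hausdorff spaces. `ULift` moves
`T` into the universe of the test spaces. -/
theorem exists_lift_kSpace {T : Type} [TopologicalSpace T] [CompactSpace T] [T2Space T]
    {P : Type u} [TopologicalSpace P] (f : C(T, P)) :
    ∃ g : C(T, KSpace P), ∀ t, (g t).val = f t := by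
  have h : Continuous fun z : ULift.{u} T => KSpace.mk (f z.down) :=
    KSpace.continuous_mk_comp (f.continuous.comp continuous_uliftDown)
  exact ⟨⟨fun t => KSpace.mk (f t), h.comp continuous_uliftUp⟩, fun _ => rfl⟩

def Prespectrum.piProj {ι : Type} (E : ι → Prespectrum.{u}) (i : ι) :
    Prespectrum.Hom (Prespectrum.pi E) (E i) where
  map n := BasedSpace.piProj (fun i => (E i).level n) i
  comm _ _ := rfl

theorem isLevelProduct_pi {ι : Type} (E : ι → Prespectrum.{u}) :
    IsLevelProduct (Prespectrum.piProj E) where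
  inj _ _ _ h := funext h
  lift n T _ _ _ f := by
    obtain ⟨g, hg⟩ := exists_lift_kSpace (P := ∀ i, (E i).level n) (ContinuousMap.pi f)
    exact ⟨g, fun i t => congrFun (hg t) i⟩

def Prespectrum.prodFst (E F : Prespectrum.{u}) : Prespectrum.Hom (E.prod F) E where
  map n := BasedSpace.prodFst (E.level n) (F.level n)
  comm _ _ := rfl

def Prespectrum.prodSnd (E F : Prespectrum.{u}) : Prespectrum.Hom (E.prod F) F where
  map n := BasedSpace.prodSnd (E.level n) (F.level n)
  comm _ _ := rfl

/-! ## Reparametrizations of the unit interval -/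

/-- The first half of the interval, doubled in speed. -/
noncomputable def firstHalf (t : I) : I := projIcc 0 1 zero_le_one (2 * (t : ℝ))

/-- The second half of the interval, doubled in speed. -/
noncomputable def secondHalf (t : I) : I := projIcc 0 1 zero_le_one (2 * (t : ℝ) - 1)

/-- A homotopy from `firstHalf` to the identity. -/
noncomputable def firstHalfHomotopy (p : I × I) : I :=
  projIcc 0 1 zero_le_one ((2 - (p.2 : ℝ)) * p.1)

/-- A homotopy from `secondHalf` to the identity. -/
noncomputable def secondHalfHomotopy (p : I × I) : I :=
  projIcc 0 1 zero_le_one ((2 - (p.2 : ℝ)) * p.1 - (1 - (p.2 : ℝ)))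

@[fun_prop]
theorem continuous_firstHalf : Continuous firstHalf :=
  continuous_projIcc.comp (by fun_prop)

@[fun_prop]
theorem continuous_secondHalf : Continuous secondHalf :=
  continuous_projIcc.comp (by fun_prop)

@[fun_prop]
theorem continuous_firstHalfHomotopy : Continuous firstHalfHomotopy :=
  continuous_projIcc.comp (by fun_prop)

@[fun_prop]
theorem continuous_secondHalfHomotopy : Continuous secondHalfHomotopy :=
  continuous_projIcc.comp (by fun_prop)

theorem firstHalf_zero : firstHalf 0 = 0 := by simp [firstHalf]

theorem firstHalf_of_le {t : I} (ht : 1 / 2 ≤ (t : ℝ)) : firstHalf t = 1 :=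
  projIcc_of_right_le _ (by linarith)

theorem secondHalf_of_le {t : I} (ht : (t : ℝ) ≤ 1 / 2) : secondHalf t = 0 :=
  projIcc_of_le_left _ (by linarith)

theorem secondHalf_one : secondHalf 1 = 1 :=
  projIcc_of_right_le _ (by norm_num)

theorem firstHalfHomotopy_zero (t : I) : firstHalfHomotopy (t, 0) = firstHalf t := by
  simp [firstHalfHomotopy, firstHalf]

theorem firstHalfHomotopy_one (t : I) : firstHalfHomotopy (t, 1) = t := by
  have : (2 - 1 : ℝ) * t = t := by ring
  simp [firstHalfHomotopy, this]

theorem firstHalfHomotopy_zero_left (s : I) : firstHalfHomotopy (0, s) = 0 := by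
  simp [firstHalfHomotopy]

theorem firstHalfHomotopy_one_left (s : I) : firstHalfHomotopy (1, s) = 1 :=
  projIcc_of_right_le _ (by have := s.2.2; simp only [Set.Icc.coe_one]; linarith)

theorem secondHalfHomotopy_zero (t : I) : secondHalfHomotopy (t, 0) = secondHalf t := by
  simp [secondHalfHomotopy, secondHalf]

theorem secondHalfHomotopy_one (t : I) : secondHalfHomotopy (t, 1) = t := by
  have : (2 - 1 : ℝ) * t = t := by ring
  simp [secondHalfHomotopy, this]

theorem secondHalfHomotopy_zero_left (s : I) : secondHalfHomotopy (0, s) = 0 :=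
  projIcc_of_le_left _ (by have := s.2.2; simp only [Set.Icc.coe_zero]; linarith)

theorem secondHalfHomotopy_one_left (s : I) : secondHalfHomotopy (1, s) = 1 :=
  projIcc_of_right_le _ (by simp only [Set.Icc.coe_one]; linarith)

/-! ## The product of suspended loops along the suspension coordinate -/

theorem suspGenLoop_apply (X : BasedSpace.{u}) {m : ℕ} (a : GenLoop (Fin m) X X.pt)
    (t : Fin (m + 1) → I) :
    suspGenLoop X m a t = X.suspMk (a.1 (fun i => t i.castSucc), t (Fin.last m)) :=
  rfl

theorem update_last_castSucc {m : ℕ} (t : Fin (m + 1) → I) (s : I) :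
    (fun i : Fin m => Function.update t (Fin.last m) s i.castSucc) = fun i => t i.castSucc :=
  funext fun i => Function.update_of_ne (Fin.castSucc_lt_last i).ne _ _

theorem transAt_suspGenLoop_apply (X : BasedSpace.{u}) {m : ℕ} (a b : GenLoop (Fin m) X X.pt)
    (t : Fin (m + 1) → I) :
    GenLoop.transAt (Fin.last m) (suspGenLoop X m a) (suspGenLoop X m b) t =
      if (t (Fin.last m) : ℝ) ≤ 1 / 2 then
        X.suspMk (a.1 (fun i => t i.castSucc), firstHalf (t (Fin.last m)))
      else X.suspMk (b.1 (fun i => t i.castSucc), secondHalf (t (Fin.last m))) := by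
  simp only [GenLoop.transAt, GenLoop.coe_copy, suspGenLoop_apply, update_last_castSucc,
    Function.update_self]
  rfl

theorem transAt_symmAt_suspGenLoop_apply (X : BasedSpace.{u}) {m : ℕ}
    (a b : GenLoop (Fin m) X X.pt) (t : Fin (m + 1) → I) :
    GenLoop.transAt (Fin.last m) (suspGenLoop X m a)
        (GenLoop.symmAt (Fin.last m) (suspGenLoop X m b)) t =
      if (t (Fin.last m) : ℝ) ≤ 1 / 2 then
        X.suspMk (a.1 (fun i => t i.castSucc), firstHalf (t (Fin.last m)))
      else X.suspMk (b.1 (fun i => t i.castSucc), σ (secondHalf (t (Fin.last m)))) := by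
  have h : ∀ i : Fin m, i.castSucc ≠ Fin.last m := fun i => (Fin.castSucc_lt_last i).ne
  simp only [GenLoop.transAt, GenLoop.symmAt, GenLoop.coe_copy, suspGenLoop_apply,
    Function.update_self, h, if_false, if_true, update_last_castSucc]
  rfl

/-- The class of a generalized loop in the homotopy group. -/
def homotopyClass {X : Type u} [TopologicalSpace X] {x : X} {m : ℕ} (a : GenLoop (Fin m) X x) :
    HomotopyGroup.Pi m X x :=
  Quotient.mk _ a

theorem homotopyGroup_mul_suspGenLoop (X : BasedSpace.{u}) {m : ℕ} (a b : GenLoop (Fin m) X X.pt) :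
    homotopyClass (suspGenLoop X m b) * homotopyClass (suspGenLoop X m a) =
    homotopyClass (GenLoop.transAt (Fin.last m) (suspGenLoop X m a) (suspGenLoop X m b)) :=
  HomotopyGroup.mul_spec (i := Fin.last m)

/-- If at each point one of two generalized loops is trivial, then the product of their
suspensions is the suspension of their union. -/
theorem homotopyGroup_mul_susp_of_disjoint (X : BasedSpace.{u}) {m : ℕ}
    (a b c : GenLoop (Fin m) X X.pt)
    (h : ∀ y, (c.1 y = a.1 y ∧ b.1 y = X.pt) ∨ (c.1 y = b.1 y ∧ a.1 y = X.pt)) :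
    homotopyGroupSusp X m (homotopyClass b) * homotopyGroupSusp X m (homotopyClass a) =
      homotopyGroupSusp X m (homotopyClass c) := by
  classical
  refine (homotopyGroup_mul_suspGenLoop X a b).trans ?_
  let r : I × (Fin (m + 1) → I) → Fin m → I := fun p i => p.2 i.castSucc
  have hr : Continuous r := by fun_prop
  let Fa : C(I × (Fin (m + 1) → I), X.susp) :=
    ⟨fun p => X.suspMk (a.1 (r p), firstHalfHomotopy (p.2 (Fin.last m), p.1)), by fun_prop⟩
  let Fb : C(I × (Fin (m + 1) → I), X.susp) :=
    ⟨fun p => X.suspMk (b.1 (r p), secondHalfHomotopy (p.2 (Fin.last m), p.1)), by fun_prop⟩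
  let A : Set (I × (Fin (m + 1) → I)) := {p | b.1 (r p) = X.pt}
  let B : Set (I × (Fin (m + 1) → I)) := {p | a.1 (r p) = X.pt}
  have hA : IsClosed A := (isClosed_point X.pt).preimage (b.1.continuous.comp hr)
  have hB : IsClosed B := (isClosed_point X.pt).preimage (a.1.continuous.comp hr)
  have hAB : ∀ p, p ∉ A → p ∈ B := fun p hp => ((h (r p)).resolve_left fun h' => hp h'.2).2
  have hFA : ∀ p ∈ B, Fa p = X.susp.pt := fun p hp => by
    change X.suspMk (a.1 (r p), _) = _
    rw [show a.1 (r p) = X.pt from hp, X.suspMk_pt]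
  have hFB : ∀ p ∈ A, Fb p = X.susp.pt := fun p hp => by
    change X.suspMk (b.1 (r p), _) = _
    rw [show b.1 (r p) = X.pt from hp, X.suspMk_pt]
  -- Wherever one loop is nontrivial the other is constant, so each of the two half-speed loops can
  -- be stretched to full length independently. The two formulas live on a closed cover, and both
  -- give the base point on the overlap.
  let F : I × (Fin (m + 1) → I) → X.susp := fun p => if p ∈ A then Fa p else Fb p
  have hF1 : EqOn F Fa A := fun p hp => if_pos hp
  have hF2 : EqOn F Fb B := fun p hp => by
    by_cases hp' : p ∈ A
    · rw [hF1 hp', hFA p hp, hFB p hp']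
    · exact if_neg hp'
  have hF : Continuous F := by
    rw [← continuousOn_univ, ← (eq_univ_of_forall fun p => by
      by_cases hp : p ∈ A
      · exact Or.inl hp
      · exact Or.inr (hAB p hp) : A ∪ B = univ)]
    exact ((Fa.continuous.continuousOn.congr hF1).union_of_isClosed
      (Fb.continuous.continuousOn.congr hF2) hA hB)
  have hend : ∀ s t, t ∈ Cube.boundary (Fin (m + 1)) → F (s, t) = X.susp.pt := by
    rintro s t ⟨i, hi⟩
    have hFa : Fa (s, t) = X.susp.pt ∧ Fb (s, t) = X.susp.pt := by
      induction i using Fin.lastCases with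
      | last =>
        constructor
        · change X.suspMk (_, firstHalfHomotopy (t (Fin.last m), s)) = _
          rcases hi with hi | hi
          · rw [hi, firstHalfHomotopy_zero_left, X.suspMk_zero]
          · rw [hi, firstHalfHomotopy_one_left, X.suspMk_one]
        · change X.suspMk (_, secondHalfHomotopy (t (Fin.last m), s)) = _
          rcases hi with hi | hi
          · rw [hi, secondHalfHomotopy_zero_left, X.suspMk_zero]
          · rw [hi, secondHalfHomotopy_one_left, X.suspMk_one]
      | cast i => exact ⟨hFA _ (a.2 _ ⟨i, hi⟩), hFB _ (b.2 _ ⟨i, hi⟩)⟩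
    change (if _ then _ else _) = _
    split_ifs
    exacts [hFa.1, hFa.2]
  have hzero : ∀ t, F (0, t) =
      GenLoop.transAt (Fin.last m) (suspGenLoop X m a) (suspGenLoop X m b) t := by
    intro t
    rw [transAt_suspGenLoop_apply]
    by_cases hp : ((0 : I), t) ∈ A
    · rw [hF1 hp]
      change X.suspMk (a.1 _, firstHalfHomotopy (t (Fin.last m), 0)) = _
      rw [firstHalfHomotopy_zero]
      split_ifs with ht
      · rfl
      · rw [firstHalf_of_le (not_le.1 ht).le, X.suspMk_one]
        rw [show b.1 (fun i => t i.castSucc) = X.pt from hp, X.suspMk_pt]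
    · have hp' := hAB _ hp
      rw [hF2 hp']
      change X.suspMk (b.1 _, secondHalfHomotopy (t (Fin.last m), 0)) = _
      rw [secondHalfHomotopy_zero]
      split_ifs with ht
      · rw [secondHalf_of_le ht, X.suspMk_zero]
        rw [show a.1 (fun i => t i.castSucc) = X.pt from hp', X.suspMk_pt]
      · rfl
  have hone : ∀ t, F (1, t) = suspGenLoop X m c t := by
    intro t
    rw [suspGenLoop_apply]
    by_cases hp : ((1 : I), t) ∈ A
    · rw [hF1 hp]
      change X.suspMk (a.1 _, firstHalfHomotopy (t (Fin.last m), 1)) = _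
      rw [firstHalfHomotopy_one]
      rcases h (fun i => t i.castSucc) with h' | h'
      · rw [h'.1]
      · rw [h'.1, h'.2, show b.1 (fun i => t i.castSucc) = X.pt from hp]
    · rw [hF2 (hAB _ hp)]
      change X.suspMk (b.1 _, secondHalfHomotopy (t (Fin.last m), 1)) = _
      rw [secondHalfHomotopy_one, ((h (fun i => t i.castSucc)).resolve_left fun h' => hp h'.2).1]
  exact Quotient.sound ⟨{
    toFun := F
    continuous_toFun := hF
    map_zero_left := hzero
    map_one_left := hone
    prop' := fun s t ht => (hend s t ht).trans
      ((GenLoop.transAt (Fin.last m) (suspGenLoop X m a) (suspGenLoop X m b)).2 t ht).symm }⟩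

/-! ## Collapsing a retract -/

/-- The map `q : X → Q` collapses the retract `i : B → X`, `p : X → B` to a point, and `B` is a
deformation retract of a neighbourhood in the following sense: there are a homotopy `H` on `X`,
starting at the identity and preserving `B`, and a function `v` on `X`, continuous away from the
base point (it is given by a function on a space `P` covering `X`), that vanishes on `B` and such
that `H` ends in `B` wherever `v` is less than one. -/
structure IsSplitCollapse {X B Q : BasedSpace.{u}} (p : BasedMap X B) (i : BasedMap B X)
    (q : BasedMap X Q) : Prop where
  retract : ∀ b, p (i b) = b
  collapse : ∀ b, q (i b) = Q.pt
  isQuotientMap : IsQuotientMap q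
  eq_or : ∀ x y, q x = q y → x = y ∨ (i (p x) = x ∧ i (p y) = y)
  exists_homotopy : ∃ (P : Type u) (_ : TopologicalSpace P) (π : C(P, X)) (v : C(P, I))
    (H : C(X × I, X)), IsQuotientMap π ∧ (∀ x y, π x = π y → v x = v y ∨ π x = X.pt) ∧
      (∀ x, H (x, 0) = x) ∧ (∀ t, H (X.pt, t) = X.pt) ∧
      (∀ b t, i (p (H (i b, t))) = H (i b, t)) ∧
      (∀ x, v x ≠ 1 → i (p (H (π x, 1))) = H (π x, 1)) ∧
      (∀ x, i (p (π x)) = π x → v x = 0 ∨ π x = X.pt)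

theorem BasedMap.isQuotientMap_susp {X Y : BasedSpace.{u}} (f : BasedMap X Y)
    (hf : IsQuotientMap f) : IsQuotientMap f.susp := by
  have h := Y.isQuotientMap_suspMk.comp (isQuotientMap_prod_unitInterval hf)
  exact IsQuotientMap.of_comp X.suspMk.continuous f.susp.toMap.continuous h

/-- The suspension of a homotopy. -/
theorem exists_susp_homotopy {X Y : BasedSpace.{u}} (H : C(X × I, Y))
    (hpt : ∀ t, H (X.pt, t) = Y.pt) :
    ∃ K : C(X.susp × I, Y.susp), ∀ x t s, K (X.suspMk (x, t), s) = Y.suspMk (H (x, s), t) := by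
  obtain ⟨K, hK⟩ := exists_homotopy_desc X.isQuotientMap_suspMk
    (⟨fun p => Y.suspMk (H (p.1.1, p.2), p.1.2), by fun_prop⟩ : C((X × I) × I, Y.susp)) (by
      have h : ∀ x ∈ X.suspSet, ∀ t, Y.suspMk (H (x.1, t), x.2) = Y.susp.pt := by
        rintro ⟨x, s⟩ hx t
        refine Y.suspMk_eq_pt ?_
        rcases hx with (rfl : x = X.pt) | hx
        · exact Or.inl (hpt t)
        · exact Or.inr hx
      intro x y t hxy
      rcases X.suspMk_eq_iff.1 hxy with rfl | ⟨hx, hy⟩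
      · rfl
      · exact (h x hx t).trans (h y hy t).symm)
  exact ⟨K, fun x t s => hK (x, t) s⟩

/-- The homotopy is suspended and the function `v` is kept, now as `(x, t) ↦ v x` on `P × I`. It
need not descend to `Σ X`, where all the ends `(x, 0)` and `(x, 1)` are identified; the clause
exempting the base point is made for this. Stability under suspension makes the section available at
every level of the suspension spectrum. -/
theorem IsSplitCollapse.susp {X B Q : BasedSpace.{u}} {p : BasedMap X B} {i : BasedMap B X}
    {q : BasedMap X Q} (h : IsSplitCollapse p i q) : IsSplitCollapse p.susp i.susp q.susp := by
  obtain ⟨P, _, π, v, H, hπ, hv, H0, Hpt, Hi, H1, hv0⟩ := h.exists_homotopy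
  refine ⟨fun b => ?_, fun b => ?_, q.isQuotientMap_susp h.isQuotientMap, fun x y hxy => ?_, ?_⟩
  · obtain ⟨⟨b, t⟩, rfl⟩ := B.isQuotientMap_suspMk.surjective b
    rw [i.susp_mk, p.susp_mk, h.retract]
  · obtain ⟨⟨b, t⟩, rfl⟩ := B.isQuotientMap_suspMk.surjective b
    rw [i.susp_mk, q.susp_mk, h.collapse, Q.suspMk_pt]
  · obtain ⟨⟨x, t⟩, rfl⟩ := X.isQuotientMap_suspMk.surjective x
    obtain ⟨⟨y, s⟩, rfl⟩ := X.isQuotientMap_suspMk.surjective y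
    rw [q.susp_mk, q.susp_mk, Q.suspMk_eq_iff] at hxy
    simp only [p.susp_mk, i.susp_mk]
    have key : ∀ x t, (q x, t) ∈ Q.suspSet → X.suspMk (i (p x), t) = X.suspMk (x, t) := by
      rintro x t (hx | ht)
      · rcases h.eq_or x X.pt (hx.trans q.map_pt.symm) with rfl | h'
        · rw [show i (p X.pt) = X.pt from (congrArg i p.map_pt).trans i.map_pt]
        · rw [h'.1]
      · rw [X.suspMk_eq_pt (p := (x, t)) (Or.inr ht), X.suspMk_eq_pt (Or.inr ht)]
    rcases hxy with hxy | ⟨hx, hy⟩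
    · obtain ⟨hxy, rfl⟩ := Prod.ext_iff.1 hxy
      rcases h.eq_or x y hxy with rfl | h'
      · exact Or.inl rfl
      · exact Or.inr ⟨by rw [h'.1], by rw [h'.2]⟩
    · exact Or.inr ⟨key x t hx, key y s hy⟩
  · obtain ⟨K, hK⟩ := exists_susp_homotopy H Hpt
    refine ⟨P × I, inferInstance, X.suspMk.comp (π.prodMap (ContinuousMap.id I)),
      ⟨fun x => v x.1, by fun_prop⟩, K,
      X.isQuotientMap_suspMk.comp (isQuotientMap_prod_unitInterval hπ), ?_, fun x => ?_,
      fun t => ?_, fun b s => ?_, ?_, ?_⟩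
    · rintro ⟨x, t⟩ ⟨y, s⟩ (hxy : X.suspMk (π x, t) = X.suspMk (π y, s))
      rcases X.suspMk_eq_iff.1 hxy with hxy | hx
      · obtain ⟨hxy, rfl⟩ := Prod.ext_iff.1 hxy
        refine (hv x y hxy).imp id fun h' => ?_
        change X.suspMk (π x, t) = _
        rw [h', X.suspMk_pt]
      · exact Or.inr (X.suspMk_eq_pt hx.1)
    · obtain ⟨⟨x, t⟩, rfl⟩ := X.isQuotientMap_suspMk.surjective x
      rw [hK, H0]
    · rw [← X.suspMk_pt 0, hK, Hpt]
    · obtain ⟨⟨b, t⟩, rfl⟩ := B.isQuotientMap_suspMk.surjective b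
      rw [i.susp_mk, hK, p.susp_mk, i.susp_mk, Hi]
    · rintro ⟨x, t⟩ hx
      change i.susp (p.susp (K (X.suspMk (π x, t), 1))) = K (X.suspMk (π x, t), 1)
      rw [hK, p.susp_mk, i.susp_mk, H1 x hx]
    · rintro ⟨x, t⟩ (hx : X.suspMk (i (p (π x)), t) = X.suspMk (π x, t))
      change v x = 0 ∨ X.suspMk (π x, t) = X.susp.pt
      rcases X.suspMk_eq_iff.1 hx with hx | hx
      · refine (hv0 x (Prod.ext_iff.1 hx).1).imp id fun h' => ?_
        rw [h', X.suspMk_pt]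
      · exact Or.inr (X.suspMk_eq_pt hx.2)

theorem IsSplitCollapse.suspIter {X B Q : BasedSpace.{u}} {p : BasedMap X B} {i : BasedMap B X}
    {q : BasedMap X Q} (h : IsSplitCollapse p i q) (n : ℕ) :
    IsSplitCollapse (p.suspIter n) (i.suspIter n) (q.suspIter n) := by
  induction n with
  | zero => exact h
  | succ n ih => exact ih.susp

/-- The loop `[φ x, -]` followed by the reverse of the loop `[ψ x, -]`, where both are cut off
at time `v x`; they have to agree at that time. -/
noncomputable def cutoffDifference {P X Y : Type u} [TopologicalSpace P] [TopologicalSpace X]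
    [TopologicalSpace Y] (f : C(X × I, Y)) (φ ψ : C(P, X)) (v : C(P, I))
    (h : ∀ x, f (φ x, v x) = f (ψ x, v x)) : C(P × I, Y) where
  toFun x := if (x.2 : ℝ) ≤ 1 / 2 then f (φ x.1, v x.1 * firstHalf x.2)
    else f (ψ x.1, v x.1 * σ (secondHalf x.2))
  continuous_toFun := by
    refine Continuous.if_le (by fun_prop) (by fun_prop) (by fun_prop) (by fun_prop) ?_
    intro x hx
    rw [firstHalf_of_le hx.ge, secondHalf_of_le hx.le, unitInterval.symm_zero, mul_one]
    exact h x.1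

/-- The section sends `[q x, t]` to the loop that follows `[φ x, -]` up to time `v x` and returns
along `[i (p (φ x)), -]`, where `φ` is the end of the deformation. Over `B` the cutoff `v` is zero
and the loop is constant, so `s` is defined on `Σ Q`. Raising the cutoff from `v` to `1` deforms `s
∘ Σ q` into the full difference of `Σ φ` and `Σ(i p φ)`, and `φ` is homotopic to the identity. -/
theorem IsSplitCollapse.exists_section {X B Q : BasedSpace.{u}} {p : BasedMap X B}
    {i : BasedMap B X} {q : BasedMap X Q} (h : IsSplitCollapse p i q) :
    ∃ s : BasedMap Q.susp X.susp,
      (∀ m (d : HomotopyGroup.Pi m Q.susp Q.susp.pt),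
        homotopyGroupMap q.susp m (homotopyGroupMap s m d) = d) ∧
      (∀ m (d : HomotopyGroup.Pi (m + 1) Q.susp Q.susp.pt),
        homotopyGroupMap p.susp (m + 1) (homotopyGroupMap s (m + 1) d) = 1) ∧
      (∀ m (c : HomotopyGroup.Pi m X X.pt),
        homotopyGroupSusp X m c = homotopyGroupMap i.susp (m + 1)
          (homotopyGroupSusp B m (homotopyGroupMap p m c)) *
            homotopyGroupMap s (m + 1) (homotopyGroupSusp Q m (homotopyGroupMap q m c))) := by
  obtain ⟨P, _, π, v, H, hπ, hv, H0, Hpt, Hi, H1, hv0⟩ := h.exists_homotopy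
  have hipt : i (p X.pt) = X.pt := (congrArg i p.map_pt).trans i.map_pt
  have hqip : ∀ x, i (p x) = x → q x = Q.pt := fun x hx => by rw [← hx, h.collapse]
  let φ : C(P, X) := ⟨fun x => H (π x, 1), by fun_prop⟩
  let ψ : C(P, X) := ⟨fun x => i (p (φ x)), i.toMap.continuous.comp (p.toMap.continuous.comp
    φ.continuous)⟩
  have hφψ : ∀ x, v x ≠ 1 → ψ x = φ x := H1
  have hφpt : ∀ x, π x = X.pt → φ x = X.pt := fun x hx => (congrArg (fun y => H (y, 1)) hx).trans
    (Hpt 1)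
  have hφeq : ∀ x y, π x = π y → φ x = φ y := fun x y hxy => congrArg (fun z => H (z, 1)) hxy
  have hψeq : ∀ x y, π x = π y → ψ x = ψ y := fun x y hxy => congrArg (fun z => i (p z))
    (hφeq x y hxy)
  have hψpt : ∀ x, π x = X.pt → ψ x = X.pt := fun x hx =>
    (congrArg (fun z => i (p z)) (hφpt x hx)).trans hipt
  -- the section, with cutoff function `max v τ`
  let vτ : C(P × I, I) := ⟨fun x => max (v x.1) x.2, by fun_prop⟩
  let D : C((P × I) × I, X.susp) := cutoffDifference X.suspMk (φ.comp ⟨Prod.fst, continuous_fst⟩)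
    (ψ.comp ⟨Prod.fst, continuous_fst⟩) vτ (by
      rintro ⟨x, τ⟩
      change X.suspMk (φ x, max (v x) τ) = X.suspMk (ψ x, max (v x) τ)
      -- The outgoing and returning paths meet at the cutoff time: if `v x = 1`, both have reached
      -- the base point of `Σ X`; otherwise `φ x` lies in the image of `B`, where `φ` and `i p φ`
      -- agree.
      by_cases hx : v x = 1
      · rw [hx, max_eq_left unitInterval.le_one', X.suspMk_one, X.suspMk_one]
      · rw [hφψ x hx])
  have hD : ∀ x τ (t : I), D ((x, τ), t) = if (t : ℝ) ≤ 1 / 2 then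
      X.suspMk (φ x, max (v x) τ * firstHalf t) else
      X.suspMk (ψ x, max (v x) τ * σ (secondHalf t)) := fun _ _ _ => rfl
  have hDzero : ∀ x τ, D ((x, τ), 0) = X.susp.pt := fun x τ => by
    rw [hD, if_pos (by norm_num), firstHalf_zero, mul_zero, X.suspMk_zero]
  have hDone : ∀ x τ, D ((x, τ), 1) = X.susp.pt := fun x τ => by
    rw [hD, if_neg (by norm_num), secondHalf_one, unitInterval.symm_one, mul_zero, X.suspMk_zero]
  have hDpt : ∀ x τ t, π x = X.pt → D ((x, τ), t) = X.susp.pt := fun x τ t hx => by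
    rw [hD, hφpt x hx, hψpt x hx, X.suspMk_pt, X.suspMk_pt, ite_self]
  have hDeq : ∀ x y τ t, π x = π y → D ((x, τ), t) = D ((y, τ), t) := fun x y τ t hxy => by
    rcases hv x y hxy with h' | h'
    · rw [hD, hD, hφeq x y hxy, hψeq x y hxy, h']
    · rw [hDpt x τ t h', hDpt y τ t (hxy.symm.trans h')]
  -- This is where `v = 0` on `B` is needed, and it holds at `τ = 0` only: for larger `τ` the map
  -- lives on `Σ X` but does not in general factor through `Σ Q`.
  have hDi : ∀ x t, i (p (π x)) = π x → D ((x, 0), t) = X.susp.pt := fun x t hx => by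
    rcases hv0 x hx with h' | h'
    · rw [hD, h', max_self, zero_mul, zero_mul, X.suspMk_zero, X.suspMk_zero, ite_self]
    · exact hDpt x 0 t h'
  have hρX : IsQuotientMap (fun x : P × I => X.suspMk (π x.1, x.2)) :=
    X.isQuotientMap_suspMk.comp (isQuotientMap_prod_unitInterval hπ)
  have hρ : IsQuotientMap (fun x : P × I => Q.suspMk (q (π x.1), x.2)) :=
    Q.isQuotientMap_suspMk.comp (isQuotientMap_prod_unitInterval (h.isQuotientMap.comp hπ))
  have hqpt : ∀ x, q (π x) = Q.pt → i (p (π x)) = π x := fun x hx => by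
    rcases h.eq_or (π x) X.pt (hx.trans q.map_pt.symm) with h' | h'
    · rw [h', hipt]
    · exact h'.1
  -- when a function on `P × I` descends to `Σ Q`
  have hdesc : ∀ {Z : Type u} (z : Z) (F : P × I → Z), (∀ x y t, π x = π y → F (x, t) = F (y, t)) →
      (∀ x t, i (p (π x)) = π x → F (x, t) = z) → (∀ x, F (x, 0) = z) → (∀ x, F (x, 1) = z) →
      ∀ x y : P × I, Q.suspMk (q (π x.1), x.2) = Q.suspMk (q (π y.1), y.2) → F x = F y := by
    rintro Z z F hF hFi hF0 hF1 ⟨x, t⟩ ⟨y, t'⟩ hxy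
    have key : ∀ x t, (q (π x), t) ∈ Q.suspSet → F (x, t) = z := by
      rintro x t (hx | (rfl : t = 0) | (rfl : t = 1))
      exacts [hFi x t (hqpt x hx), hF0 x, hF1 x]
    rcases Q.suspMk_eq_iff.1 hxy with hxy | ⟨hx, hy⟩
    · obtain ⟨hxy, (rfl : t = t')⟩ := Prod.ext_iff.1 hxy
      rcases h.eq_or _ _ hxy with h' | h'
      · exact hF x y t h'
      · rw [hFi x t h'.1, hFi y t h'.2]
    · rw [key x t hx, key y t' hy]
  obtain ⟨s, hs⟩ := exists_desc hρ (⟨fun x => D ((x.1, 0), x.2), by fun_prop⟩ : C(P × I, X.susp))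
    (hdesc X.susp.pt _ (fun x y t => hDeq x y 0 t) hDi (fun x => hDzero x 0) fun x => hDone x 0)
  replace hs : ∀ x t, s (Q.suspMk (q (π x), t)) = D ((x, 0), t) := fun x t => hs (x, t)
  obtain ⟨x₀, hx₀⟩ := hπ.surjective X.pt
  have hspt : s Q.susp.pt = X.susp.pt := by
    rw [← Q.suspMk_zero (q (π x₀)), hs, hDzero]
  have hsurj : ∀ z : Q.susp, ∃ x t, Q.suspMk (q (π x), t) = z := fun z => by
    obtain ⟨⟨x, t⟩, hx⟩ := hρ.surjective z
    exact ⟨x, t, hx⟩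
  have hsurjX : ∀ z : X.susp, ∃ x t, X.suspMk (π x, t) = z := fun z => by
    obtain ⟨⟨x, t⟩, hx⟩ := hρX.surjective z
    exact ⟨x, t, hx⟩
  refine ⟨⟨s, hspt⟩, fun m d => ?_, fun m d => ?_, fun m c => ?_⟩
  · -- `Σ q ∘ s` is homotopic to the identity
    obtain ⟨G, hG⟩ := exists_homotopy_desc hρ (⟨fun x => Q.suspMk (q (H (π x.1.1, σ x.2)),
      firstHalfHomotopy (x.1.2, x.2)), by have := q.toMap.continuous; fun_prop⟩ :
        C((P × I) × I, Q.susp)) (by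
        intro x y τ
        refine hdesc Q.susp.pt (fun x => Q.suspMk (q (H (π x.1, σ τ)),
          firstHalfHomotopy (x.2, τ))) (fun x y t hxy => ?_) (fun x t hx => ?_) (fun x => ?_)
          (fun x => ?_) x y
        · simp only [hxy]
        · have := Hi (p (π x)) (σ τ)
          rw [hx] at this
          simp only [hqip _ this, Q.suspMk_pt]
        · simp only [firstHalfHomotopy_zero_left, Q.suspMk_zero]
        · simp only [firstHalfHomotopy_one_left, Q.suspMk_one])
    replace hG : ∀ x t τ, G (Q.suspMk (q (π x), t), τ) = Q.suspMk (q (H (π x, σ τ)),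
      firstHalfHomotopy (t, τ)) := fun x t τ => hG (x, t) τ
    rw [← homotopyGroupMap_comp]
    refine (congrFun (homotopyGroupMap_congr_of_homotopy (g := BasedMap.id _) G (fun z => ?_)
      (fun z => ?_) (fun τ => ?_) m) d).trans (homotopyGroupMap_id _ _ _)
    -- At `τ = 0`, the returning half of `s` vanishes under `Σ q` because `q i` is trivial. On the
    -- outgoing half the cutoff changes nothing: it equals `1`, or else `q (φ x)` is the base point.
    · obtain ⟨x, t, rfl⟩ := hsurj z
      rw [hG, firstHalfHomotopy_zero, unitInterval.symm_zero]
      change _ = q.susp (s _)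
      rw [hs, hD, max_eq_left unitInterval.nonneg']
      by_cases hx : v x = 1
      · rw [hx, one_mul, one_mul]
        split_ifs with ht
        · rfl
        · rw [q.susp_mk, firstHalf_of_le (not_le.1 ht).le, Q.suspMk_one]
          change _ = Q.suspMk (q (i (p (φ x))), _)
          rw [h.collapse, Q.suspMk_pt]
      · have h1 : q (φ x) = Q.pt := hqip _ (hφψ x hx)
        have h2 : q (ψ x) = Q.pt := h.collapse _
        rw [apply_ite q.susp, q.susp_mk, q.susp_mk, h1, h2, Q.suspMk_pt, Q.suspMk_pt, ite_self]
        change Q.suspMk (q (φ x), _) = _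
        rw [h1, Q.suspMk_pt]
    · obtain ⟨x, t, rfl⟩ := hsurj z
      rw [hG, firstHalfHomotopy_one, unitInterval.symm_one, H0]
      rfl
    · rw [← Q.suspMk_zero (q (π x₀)), hG, firstHalfHomotopy_zero_left, Q.suspMk_zero]
      exact (Q.suspMk_zero _).symm
  · -- `Σ p ∘ s` is null homotopic
    let W : C((P × I) × I, B.susp) := cutoffDifference B.suspMk
      (⟨fun x => p (φ x.1), p.toMap.continuous.comp (by fun_prop)⟩ : C(P × I, B))
      (⟨fun x => p (φ x.1), p.toMap.continuous.comp (by fun_prop)⟩ : C(P × I, B))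
      ⟨fun x => v x.1 * σ x.2, by fun_prop⟩ (fun _ => rfl)
    have hW : ∀ x τ (t : I), W ((x, τ), t) = if (t : ℝ) ≤ 1 / 2 then
        B.suspMk (p (φ x), v x * σ τ * firstHalf t) else
        B.suspMk (p (φ x), v x * σ τ * σ (secondHalf t)) := fun _ _ _ => rfl
    have hWpt : ∀ x τ t, π x = X.pt → W ((x, τ), t) = B.susp.pt := fun x τ t hx => by
      rw [hW, hφpt x hx, p.map_pt, B.suspMk_pt, B.suspMk_pt, ite_self]
    have hW0 : ∀ x τ, W ((x, τ), 0) = B.susp.pt := fun x τ => by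
      rw [hW, if_pos (by norm_num), firstHalf_zero, mul_zero, B.suspMk_zero]
    -- Since `p i = id`, both halves of `Σ p ∘ s` run along the same path `[p (φ x), -]`, so they
    -- meet at any cutoff. Scaling the cutoff by `1 - τ` contracts the loop.
    obtain ⟨G, hG⟩ := exists_homotopy_desc hρ (⟨fun x => W ((x.1.1, x.2), x.1.2), by fun_prop⟩ :
        C((P × I) × I, B.susp)) (by
        intro x y τ
        refine hdesc B.susp.pt (fun x => W ((x.1, τ), x.2)) (fun x y t hxy => ?_)
          (fun x t hx => ?_) (fun x => hW0 x τ) (fun x => ?_) x y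
        · rcases hv x y hxy with h' | h'
          · simp only [hW, hφeq x y hxy, h']
          · exact (hWpt x τ t h').trans (hWpt y τ t (hxy.symm.trans h')).symm
        · rcases hv0 x hx with h' | h'
          · simp only [hW, h', zero_mul, B.suspMk_zero, ite_self]
          · exact hWpt x τ t h'
        · simp only [hW]
          rw [if_neg (by norm_num), secondHalf_one, unitInterval.symm_one, mul_zero, B.suspMk_zero])
    replace hG : ∀ x t τ, G (Q.suspMk (q (π x), t), τ) = W ((x, τ), t) := fun x t τ => hG (x, t) τ
    rw [← homotopyGroupMap_comp]
    refine (congrFun (homotopyGroupMap_congr_of_homotopy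
      (g := ⟨ContinuousMap.const _ B.susp.pt, rfl⟩) G (fun z => ?_)
      (fun z => ?_) (fun τ => ?_) (m + 1)) d).trans (homotopyGroupMap_eq_one (fun _ => rfl) _ _)
    · obtain ⟨x, t, rfl⟩ := hsurj z
      rw [hG, hW, unitInterval.symm_zero, mul_one]
      change _ = p.susp (s _)
      rw [hs, hD, max_eq_left unitInterval.nonneg', apply_ite p.susp, p.susp_mk, p.susp_mk]
      change _ = if _ then _ else B.suspMk (p (i (p (φ x))), _)
      rw [h.retract]
    · obtain ⟨x, t, rfl⟩ := hsurj z
      rw [hG, hW, unitInterval.symm_one, mul_zero, zero_mul, zero_mul, B.suspMk_zero, ite_self]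
      rfl
    · rw [← Q.suspMk_zero (q (π x₀)), hG, hW0]
  · -- the difference of the two loops, without cutoff
    obtain ⟨c, rfl⟩ : ∃ a, homotopyClass a = c := Quotient.exists_rep c
    obtain ⟨G, hG⟩ := exists_homotopy_desc hρX (⟨fun x => D ((x.1.1, x.2), x.1.2), by fun_prop⟩ :
        C((P × I) × I, X.susp)) (by
        rintro ⟨x, t⟩ ⟨y, t'⟩ τ hxy
        have key : ∀ x t, (π x, t) ∈ X.suspSet → D ((x, τ), t) = X.susp.pt := by
          rintro x t (hx | (rfl : t = 0) | (rfl : t = 1))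
          exacts [hDpt x τ t hx, hDzero x τ, hDone x τ]
        rcases X.suspMk_eq_iff.1 hxy with hxy | ⟨hx, hy⟩
        · obtain ⟨hxy, (rfl : t = t')⟩ := Prod.ext_iff.1 hxy
          exact hDeq x y τ t hxy
        · exact (key x t hx).trans (key y t' hy).symm)
    replace hG : ∀ x t τ, G (X.suspMk (π x, t), τ) = D ((x, τ), t) := fun x t τ => hG (x, t) τ
    let φX : BasedMap X X := ⟨⟨fun x => H (x, 1), by fun_prop⟩, Hpt 1⟩
    let ip : BasedMap X X := i.comp p
    have hGpt : ∀ τ, G (X.susp.pt, τ) = X.susp.pt := fun τ =>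
      (congrArg (fun z => G (z, τ)) (X.suspMk_zero (π x₀)).symm).trans
        ((hG _ _ _).trans (hDzero _ _))
    let d : BasedMap X.susp X.susp := ⟨⟨fun z => G (z, 1), by fun_prop⟩, hGpt 1⟩
    have hd : ∀ x (t : I), d (X.suspMk (x, t)) = if (t : ℝ) ≤ 1 / 2 then
        X.suspMk (φX x, firstHalf t) else X.suspMk (ip (φX x), σ (secondHalf t)) := fun x t => by
      obtain ⟨x, rfl⟩ := hπ.surjective x
      change G (X.suspMk (π x, t), 1) = _
      rw [hG, hD, max_eq_right unitInterval.le_one', one_mul, one_mul]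
      rfl
    -- The homotopy `G` raises the cutoff from `v` at `τ = 0`, where it is `s ∘ Σ q`, to `1` at `τ =
    -- 1`, where it is `d`.
    have hsd : homotopyGroupMap ((⟨s, hspt⟩ : BasedMap _ _).comp q.susp) (m + 1) =
        homotopyGroupMap d (m + 1) := by
      refine homotopyGroupMap_congr_of_homotopy G (fun z => ?_) (fun z => rfl) hGpt _
      obtain ⟨x, t, rfl⟩ := hsurjX z
      rw [hG]
      exact (hs x t).symm
    have hφid : homotopyGroupMap φX m = homotopyGroupMap (BasedMap.id X) m :=
      (homotopyGroupMap_congr_of_homotopy H H0 (fun _ => rfl) Hpt m).symm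
    -- In a product of classes the loop traversed second is the left factor, so the reversed loop
    -- contributes an inverse on the left. The order matters: for `m = 0` the group need not be
    -- commutative. It is the order in which the factors cancel at the end.
    have hmul : homotopyGroupMap d (m + 1) (homotopyGroupSusp X m (homotopyClass c)) =
        (homotopyGroupSusp X m (homotopyGroupMap ip m (homotopyGroupMap φX m
          (homotopyClass c))))⁻¹ *
        homotopyGroupSusp X m (homotopyGroupMap φX m (homotopyClass c)) := by
      let a := genLoopMap φX c
      let b := genLoopMap ip a
      have h1 : (homotopyClass (suspGenLoop X m b))⁻¹ =
          homotopyClass (GenLoop.symmAt (Fin.last m) (suspGenLoop X m b)) :=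
        HomotopyGroup.inv_spec
      have h2 : homotopyClass (GenLoop.symmAt (Fin.last m) (suspGenLoop X m b)) *
          homotopyClass (suspGenLoop X m a) = homotopyClass (GenLoop.transAt (Fin.last m)
            (suspGenLoop X m a) (GenLoop.symmAt (Fin.last m) (suspGenLoop X m b))) :=
        HomotopyGroup.mul_spec
      refine Eq.trans ?_ (h2.symm.trans (congrArg (· * _) h1.symm))
      refine congrArg homotopyClass (GenLoop.ext _ _ fun t => ?_)
      rw [transAt_symmAt_suspGenLoop_apply]
      exact hd _ _
    rw [hφid, homotopyGroupMap_id] at hmul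
    have h1 : homotopyGroupMap i.susp (m + 1)
        (homotopyGroupSusp B m (homotopyGroupMap p m (homotopyClass c))) =
        homotopyGroupSusp X m (homotopyGroupMap ip m (homotopyClass c)) := by
      rw [← homotopyGroupSusp_map, ← homotopyGroupMap_comp]
    have h2 : homotopyGroupMap ⟨s, hspt⟩ (m + 1)
        (homotopyGroupSusp Q m (homotopyGroupMap q m (homotopyClass c))) =
        homotopyGroupMap d (m + 1) (homotopyGroupSusp X m (homotopyClass c)) := by
      rw [homotopyGroupSusp_map q, ← homotopyGroupMap_comp, hsd]
    rw [h1, h2, hmul, mul_inv_cancel_left]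

theorem suspensionSpectrum_stabilize (X : BasedSpace.{u}) (m n : ℕ)
    (c : HomotopyGroup.Pi m (X.suspIter n) (X.suspIter n).pt) :
    (suspensionSpectrum X).stabilize m n c = homotopyGroupSusp (X.suspIter n) m c :=
  homotopyGroupMap_id _ _ _

/-- If `Q` is obtained from `X` by collapsing the retract `B`, then the stable homotopy groups of
`X` are the products of those of `B` and of `Q`. -/
theorem IsSplitCollapse.bijective {X B Q : BasedSpace.{u}} {p : BasedMap X B}
    {i : BasedMap B X} {q : BasedMap X Q} (h : IsSplitCollapse p i q) (k : ℤ) :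
    (∀ α β, (suspensionSpectrumMap p).stableHomotopyMap k α =
        (suspensionSpectrumMap p).stableHomotopyMap k β →
      (suspensionSpectrumMap q).stableHomotopyMap k α =
        (suspensionSpectrumMap q).stableHomotopyMap k β → α = β) ∧
    ∀ b d, ∃ α, (suspensionSpectrumMap p).stableHomotopyMap k α = b ∧
      (suspensionSpectrumMap q).stableHomotopyMap k α = d := by
  -- The index `true` stands for `B` and `false` for `Q`.
  let F : Bool → Prespectrum.{u} := Bool.rec (suspensionSpectrum Q) (suspensionSpectrum B)
  let f : ∀ j, Prespectrum.Hom (suspensionSpectrum X) (F j) :=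
    Bool.rec (suspensionSpectrumMap q) (suspensionSpectrumMap p)
  have hf : JointlyBijective f := by
    refine jointlyBijective_of_stabilize f (fun m n c c' hc => ?_) fun m n b => ?_
    · obtain ⟨s, -, -, hs⟩ := (h.suspIter n).exists_section
      have hp : homotopyGroupMap (p.suspIter n) m c = homotopyGroupMap (p.suspIter n) m c' :=
        hc true
      have hq : homotopyGroupMap (q.suspIter n) m c = homotopyGroupMap (q.suspIter n) m c' :=
        hc false
      refine (suspensionSpectrum_stabilize X m n c).trans
        (Eq.trans ?_ (suspensionSpectrum_stabilize X m n c').symm)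
      rw [hs m c, hs m c', hp, hq]
    · obtain ⟨s, hqs, hps, -⟩ := (h.suspIter n).exists_section
      let b₁ : HomotopyGroup.Pi m (B.suspIter n) (B.suspIter n).pt := b true
      let b₀ : HomotopyGroup.Pi m (Q.suspIter n) (Q.suspIter n).pt := b false
      -- Under `q` the first factor dies and the second returns `b₀`; under `p` the second dies and
      -- the first returns `b₁`, both up to suspension.
      refine ⟨(homotopyGroupMap (i.suspIter n).susp (m + 1) (homotopyGroupSusp _ m b₁) *
        homotopyGroupMap s (m + 1) (homotopyGroupSusp _ m b₀) :
          HomotopyGroup.Pi (m + 1) (X.suspIter n).susp (X.suspIter n).susp.pt), ?_⟩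
      rintro (_ | _)
      · refine Eq.trans ?_ (suspensionSpectrum_stabilize Q m n b₀).symm
        refine (homotopyGroupMap_mul (q.suspIter n).susp m _ _).trans ?_
        rw [hqs, ← homotopyGroupMap_comp, homotopyGroupMap_eq_one, one_mul]
        exact (h.suspIter n).susp.collapse
      · refine Eq.trans ?_ (suspensionSpectrum_stabilize B m n b₁).symm
        refine (homotopyGroupMap_mul (p.suspIter n).susp m _ _).trans ?_
        have hid : (p.suspIter n).susp.comp (i.suspIter n).susp = BasedMap.id _ :=
          BasedMap.ext (h.suspIter n).susp.retract
        rw [hps, ← homotopyGroupMap_comp, hid, homotopyGroupMap_id, mul_one]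
  refine ⟨fun α β hp hq => (hf k).1 (funext ?_), fun b d => ?_⟩
  · rintro (_ | _)
    exacts [hq, hp]
  · obtain ⟨α, hα⟩ := (hf k).2 (Bool.rec d b)
    exact ⟨α, congrFun hα true, congrFun hα false⟩

/-! ## Maps out of a wedge -/

def BasedMap.const (X Y : BasedSpace.{u}) : BasedMap X Y := ⟨ContinuousMap.const _ Y.pt, rfl⟩

/-- The based map `⋁ᵢ Xᵢ → Z` with given restrictions to the summands. -/
def BasedSpace.wedgeDesc {ι : Type} {X : ι → BasedSpace.{u}} {Z : BasedSpace.{u}}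
    (f : ∀ i, BasedMap (X i) Z) : BasedMap (BasedSpace.wedge X) Z :=
  BasedSpace.collapseDesc _ _ _ _
    ⟨fun p : (Σ o, BasedSpace.addPoint X o) => match p with
      | ⟨none, _⟩ => Z.pt
      | ⟨some i, x⟩ => f i x, continuous_sigma fun o => by
        cases o with
        | none => exact continuous_const
        | some i => exact (f i).toMap.continuous⟩ (by
    rintro ⟨_ | i, x⟩ hx
    · rfl
    · exact (congrArg (f i) hx).trans (f i).map_pt)

theorem BasedSpace.wedge_cases {ι : Type} {X : ι → BasedSpace.{u}} (w : BasedSpace.wedge X) :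
    w = (BasedSpace.wedge X).pt ∨ ∃ i x, w = BasedSpace.wedgeIncl X i x := by
  induction w using Quotient.inductionOn with
  | h p =>
    obtain ⟨_ | i, x⟩ := p
    · exact Or.inl rfl
    · exact Or.inr ⟨i, x, rfl⟩

/-! ## Well-based spaces -/

/-- The unit interval, based at `0`. -/
def BasedSpace.interval : BasedSpace.{u} where
  carrier := ULift.{u} I
  pt := ⟨0⟩

/-- In a well-based space, a neighbourhood of the base point can be deformed into the base point
through a based homotopy defined on the whole space. -/
theorem BasedSpace.WellBased.exists_homotopy {X : BasedSpace.{u}} (hX : X.WellBased) :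
    ∃ (H : C(X × I, X)) (v : C(X, I)), (∀ x, H (x, 0) = x) ∧ (∀ t, H (X.pt, t) = X.pt) ∧
      v X.pt = 0 ∧ ∀ x, v x ≠ 1 → H (x, 1) = X.pt := by
  let Y : Bool → BasedSpace.{u} := Bool.rec BasedSpace.interval X
  let iX : BasedMap X (BasedSpace.wedge Y) := BasedSpace.wedgeIncl Y true
  let iI : BasedMap BasedSpace.interval (BasedSpace.wedge Y) := BasedSpace.wedgeIncl Y false
  let c : BasedMap (BasedSpace.wedge Y) X :=
    BasedSpace.wedgeDesc (Bool.rec (BasedMap.const _ _) (BasedMap.id X))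
  let w : BasedMap (BasedSpace.wedge Y) BasedSpace.interval :=
    BasedSpace.wedgeDesc (Bool.rec (BasedMap.id _) (BasedMap.const _ _))
  -- The extension property is applied to the inclusion of `X` into `X` with a whisker attached, the
  -- base point moving out along the whisker. Retracting the whisker gives `H`, and the final height
  -- on the whisker, reversed, gives `v`.
  obtain ⟨r, hr0, hr⟩ := hX (BasedSpace.wedge Y) iX.toMap
    ⟨fun p => iI ⟨p.2⟩, iI.toMap.continuous.comp (continuous_uliftUp.comp continuous_snd)⟩
    (fun _ => iI.map_pt.trans iX.map_pt.symm)
  replace hr : ∀ t, r (X.pt, t) = iI ⟨t⟩ := hr PUnit.unit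
  refine ⟨c.toMap.comp r, ⟨fun x => σ (w (r (x, 1))).down, ?_⟩, fun x => ?_, fun t => ?_, ?_,
    fun x hx => ?_⟩
  · have := continuous_uliftDown.comp (w.toMap.continuous.comp r.continuous)
    exact unitInterval.continuous_symm.comp (this.comp (by fun_prop))
  · exact congrArg c (hr0 x)
  · exact congrArg c (hr t)
  · change σ (w (r (X.pt, 1))).down = 0
    rw [hr]
    exact unitInterval.symm_one
  · change c (r (x, 1)) = X.pt
    -- If `v x ≠ 1`, the end point `r (x, 1)` has positive height, so it lies on the whisker, which
    -- `c` sends to the base point.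
    rcases BasedSpace.wedge_cases (r (x, 1)) with h | ⟨i, y, h⟩
    · rw [h, c.map_pt]
    · cases i with
      | false =>
        rw [h]
        rfl
      | true =>
        refine absurd ?_ hx
        change σ (w (r (x, 1))).down = 1
        rw [h]
        exact unitInterval.symm_zero

/-! ## Partial smash products -/

section PartialSmash

variable {ι : Type} {X : ι → BasedSpace.{u}}

/-- The points of `∏ᵢ Xᵢ` that are sent to the base point of the quotient of `∏_{i ∈ R} Xᵢ` by
the points with some coordinate in `S` at the base point. -/
def IsCollapsed (S R : Finset ι) (x : BasedSpace.pi X) : Prop :=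
  (∃ i ∈ S, BasedSpace.piProj X i x = (X i).pt) ∨ ∀ i ∈ R, BasedSpace.piProj X i x = (X i).pt

theorem IsCollapsed.mono {S S' R R' : Finset ι} (hS : S ⊆ S') (hR : R' ⊆ R) (x : BasedSpace.pi X)
    (hx : IsCollapsed S R x) : IsCollapsed S' R' x :=
  hx.imp (fun ⟨i, hi, hx⟩ => ⟨i, hS hi, hx⟩) fun h i hi => h i (hR hi)

/-- The map `π` exhibits `M` as the quotient of `∏_{i ∈ R} Xᵢ` by the points with some coordinate
in `S` at the base point. -/
structure IsPartialSmash (S R : Finset ι) {M : BasedSpace.{u}}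
    (π : BasedMap (BasedSpace.pi X) M) : Prop where
  isQuotientMap : IsQuotientMap π
  eq_iff : ∀ x y, π x = π y ↔
    (∀ i ∈ R, BasedSpace.piProj X i x = BasedSpace.piProj X i y) ∨
      (IsCollapsed S R x ∧ IsCollapsed S R y)

theorem isCollapsed_pt (S R : Finset ι) : IsCollapsed S R (BasedSpace.pi X).pt :=
  Or.inr fun _ _ => rfl

theorem IsPartialSmash.eq_pt {S R : Finset ι} {M : BasedSpace.{u}}
    {π : BasedMap (BasedSpace.pi X) M} (h : IsPartialSmash S R π) {x : BasedSpace.pi X}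
    (hx : IsCollapsed S R x) : π x = M.pt :=
  ((h.eq_iff _ _).2 (Or.inr ⟨hx, isCollapsed_pt S R⟩)).trans π.map_pt

theorem BasedSpace.pi_ext {x y : BasedSpace.pi X}
    (h : ∀ i, BasedSpace.piProj X i x = BasedSpace.piProj X i y) : x = y :=
  funext h

/-- A map with a section is a quotient map. -/
theorem isQuotientMap_of_section {X Y : BasedSpace.{u}} (f : BasedMap X Y) (g : BasedMap Y X)
    (h : ∀ y, f (g y) = y) : IsQuotientMap f :=
  IsQuotientMap.of_comp g.toMap.continuous f.toMap.continuous (by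
    rw [show (f : X → Y) ∘ g = id from funext h]
    exact IsQuotientMap.id)

/-- Every partial smash product is presented as a quotient of the full product `∏ᵢ Xᵢ`. Maps between
two of them, and equations between such maps, then reduce to statements about the points of one
space. The projection to the coordinates in `R` is a quotient map because filling in base points is
a section. -/
theorem exists_isPartialSmash [DecidableEq ι] {S R : Finset ι} (hSR : S ⊆ R) :
    ∃ (M : BasedSpace.{u}) (π : BasedMap (BasedSpace.pi X) M), IsPartialSmash S R π := by
  let Y : R → BasedSpace.{u} := fun i => X i
  let f : BasedMap (BasedSpace.pi X) (BasedSpace.pi Y) :=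
    BasedSpace.piLift fun i : R => BasedSpace.piProj X i
  let g : BasedMap (BasedSpace.pi Y) (BasedSpace.pi X) := BasedSpace.piLift fun i =>
    if h : i ∈ R then (BasedSpace.piProj Y ⟨i, h⟩ : BasedMap _ (X i)) else BasedMap.const _ _
  have hfg : ∀ y, f (g y) = y := fun y => BasedSpace.pi_ext fun i => by
    have h : BasedSpace.piProj X i (g y) = (if h : (i : ι) ∈ R then BasedSpace.piProj Y ⟨i, h⟩
      else BasedMap.const (BasedSpace.pi Y) (X i) : BasedMap (BasedSpace.pi Y) (X i)) y := rfl
    rw [dif_pos i.2] at h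
    exact h
  let A : Set (BasedSpace.pi Y) := {y | (∃ i : R, (i : ι) ∈ S ∧ BasedSpace.piProj Y i y = (Y i).pt)
    ∨ ∀ i, BasedSpace.piProj Y i y = (Y i).pt}
  have hA : IsClosed A := by
    have hcl : ∀ i, IsClosed {y | BasedSpace.piProj Y i y = (Y i).pt} := fun i =>
      (isClosed_point _).preimage (BasedSpace.piProj Y i).toMap.continuous
    have h : A = (⋃ i : {i : R // (i : ι) ∈ S}, {y | BasedSpace.piProj Y i y = (Y i).pt}) ∪
        {y | ∀ i, BasedSpace.piProj Y i y = (Y i).pt} := by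
      ext y
      refine or_congr ⟨fun ⟨i, hi, hy⟩ => Set.mem_iUnion.2 ⟨⟨i, hi⟩, hy⟩, fun hy => ?_⟩ Iff.rfl
      obtain ⟨i, hi⟩ := Set.mem_iUnion.1 hy
      exact ⟨i.1, i.2, hi⟩
    rw [h, Set.ofPred_forall]
    refine IsClosed.union ?_ (isClosed_iInter hcl)
    exact isClosed_iUnion_of_finite fun i : {i : R // (i : ι) ∈ S} => hcl (i : R)
  have hApt : (BasedSpace.pi Y).pt ∈ A := Or.inr fun _ => rfl
  let c : BasedMap (BasedSpace.pi Y) (BasedSpace.collapse A hA _ hApt) :=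
    ⟨BasedSpace.collapseMk A hA _ hApt, rfl⟩
  have hAf : ∀ x, f x ∈ A ↔ IsCollapsed S R x := by
    intro x
    refine or_congr ⟨?_, ?_⟩ ⟨fun h i hi => h ⟨i, hi⟩, fun h i => h i i.2⟩
    · rintro ⟨i, hi, hx⟩
      exact ⟨i, hi, hx⟩
    · rintro ⟨i, hi, hx⟩
      exact ⟨⟨i, hSR hi⟩, hi, hx⟩
  refine ⟨_, c.comp f, IsQuotientMap.comp (g := c)
    (isQuotientMap_quotient_mk' (s := collapseSetoid A))
    (isQuotientMap_of_section f g hfg), fun x y => ?_⟩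
  refine (Collapse.mk_eq_iff (A := A) (x := f x) (y := f y)).trans (or_congr ?_ ?_)
  · constructor
    · exact fun h i hi => congrArg (BasedSpace.piProj Y ⟨i, hi⟩) h
    · exact fun h => BasedSpace.pi_ext fun i => h i i.2
  · rw [hAf, hAf]

/-- The map of `∏ᵢ Xᵢ` to itself replacing the `j`-th coordinate by the base point. -/
noncomputable def eraseCoord [DecidableEq ι] (X : ι → BasedSpace.{u}) (j : ι) :
    BasedMap (BasedSpace.pi X) (BasedSpace.pi X) :=
  BasedSpace.piLift fun i => if i = j then BasedMap.const _ _ else BasedSpace.piProj X i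

theorem eraseCoord_self [DecidableEq ι] (j : ι) (x : BasedSpace.pi X) :
    BasedSpace.piProj X j (eraseCoord X j x) = (X j).pt := by
  change (if j = j then BasedMap.const _ _ else BasedSpace.piProj X j : BasedMap _ _) x = _
  rw [if_pos rfl]
  rfl

theorem eraseCoord_ne [DecidableEq ι] {i j : ι} (h : i ≠ j) (x : BasedSpace.pi X) :
    BasedSpace.piProj X i (eraseCoord X j x) = BasedSpace.piProj X i x := by
  change (if i = j then BasedMap.const _ _ else BasedSpace.piProj X i : BasedMap _ _) x = _
  rw [if_neg h]

theorem exists_pi_homotopy (H : ∀ i, C(X i × I, X i)) :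
    ∃ K : C(BasedSpace.pi X × I, BasedSpace.pi X), ∀ x t i,
      BasedSpace.piProj X i (K (x, t)) = H i (BasedSpace.piProj X i x, t) := by
  have h : Continuous fun (p : BasedSpace.pi X × I) i => H i (BasedSpace.piProj X i p.1, p.2) :=
    continuous_pi fun i => (H i).continuous.comp
      (((BasedSpace.piProj X i).toMap.continuous.comp continuous_fst).prodMk continuous_snd)
  exact ⟨⟨_, KSpace.continuous_mk_comp (P := ∀ i, X i) h⟩, fun _ _ _ => rfl⟩

/-- Collapsing one more coordinate in a partial smash product. -/
theorem IsPartialSmash.exists_isSplitCollapse [DecidableEq ι] (hX : ∀ i, (X i).WellBased)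
    {S R : Finset ι} {j : ι} (hj : j ∈ R) (hjS : j ∉ S) {M B Q : BasedSpace.{u}}
    {π : BasedMap (BasedSpace.pi X) M} {πB : BasedMap (BasedSpace.pi X) B}
    {πQ : BasedMap (BasedSpace.pi X) Q} (h : IsPartialSmash S R π)
    (hB : IsPartialSmash S (R.erase j) πB) (hQ : IsPartialSmash (insert j S) R πQ) :
    ∃ (p : BasedMap M B) (i : BasedMap B M) (q : BasedMap M Q), IsSplitCollapse p i q ∧
      (∀ x, p (π x) = πB x) ∧ ∀ x, q (π x) = πQ x := by
  have hcB : ∀ x, IsCollapsed S R x → IsCollapsed (X := X) S (R.erase j) x := 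
    IsCollapsed.mono subset_rfl (Finset.erase_subset j R)
  have hcQ : ∀ x, IsCollapsed S R x → IsCollapsed (X := X) (insert j S) R x := 
    IsCollapsed.mono (Finset.subset_insert j S) subset_rfl
  -- This makes the inclusion of the retract well defined. As `j ∉ S`, erasing the `j`-th coordinate
  -- leaves the coordinates in `S` untouched.
  have hce : ∀ x, IsCollapsed S (R.erase j) x → IsCollapsed S R (eraseCoord X j x) := by
    rintro x (⟨i, hi, hx⟩ | hx)
    · exact Or.inl ⟨i, hi, (eraseCoord_ne (ne_of_mem_of_not_mem hi hjS) x).trans hx⟩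
    · refine Or.inr fun i hi => ?_
      by_cases hij : i = j
      · rw [hij, eraseCoord_self]
      · rw [eraseCoord_ne hij, hx i (Finset.mem_erase.2 ⟨hij, hi⟩)]
  obtain ⟨p, hp⟩ := π.exists_desc h.isQuotientMap πB fun x y hxy => by
    rw [hB.eq_iff]
    exact ((h.eq_iff x y).1 hxy).imp (fun h i hi => h i (Finset.mem_of_mem_erase hi))
      (And.imp (hcB x) (hcB y))
  obtain ⟨q, hq⟩ := π.exists_desc h.isQuotientMap πQ fun x y hxy => by
    rw [hQ.eq_iff]
    exact ((h.eq_iff x y).1 hxy).imp id (And.imp (hcQ x) (hcQ y))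
  obtain ⟨i, hi⟩ := πB.exists_desc hB.isQuotientMap (π.comp (eraseCoord X j)) fun x y hxy => by
    refine (h.eq_iff _ _).2 (((hB.eq_iff x y).1 hxy).imp (fun h i hi => ?_)
      (And.imp (hce x) (hce y)))
    by_cases hij : i = j
    · rw [hij, eraseCoord_self, eraseCoord_self]
    · rw [eraseCoord_ne hij, eraseCoord_ne hij, h i (Finset.mem_erase.2 ⟨hij, hi⟩)]
  replace hi : ∀ x, i (πB x) = π (eraseCoord X j x) := hi
  have hip : ∀ x, i (p (π x)) = π (eraseCoord X j x) := fun x => by rw [hp, hi]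
  have herase : ∀ x : BasedSpace.pi X, BasedSpace.piProj X j x = (X j).pt →
      eraseCoord X j x = x := by
    intro x hx
    refine BasedSpace.pi_ext fun l => ?_
    by_cases hl : l = j
    · rw [hl, eraseCoord_self, hx]
    · rw [eraseCoord_ne hl]
  -- The points that `Q` collapses are exactly of the kind required: they lie in the retract, either
  -- because the `j`-th coordinate is trivial or because they are already the base point of `M`.
  have hcol : ∀ x, IsCollapsed (insert j S) R x → i (p (π x)) = π x := by
    rintro x (⟨l, hl, hx⟩ | hx)
    · rw [hip]
      rcases Finset.mem_insert.1 hl with rfl | hl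
      · rw [herase x hx]
      · rw [h.eq_pt (Or.inl ⟨l, hl, hx⟩), h.eq_pt (Or.inl ⟨l, hl, ?_⟩)]
        rw [eraseCoord_ne (ne_of_mem_of_not_mem hl hjS), hx]
    · rw [hip, herase x (hx j hj)]
  -- All coordinates are deformed simultaneously. Each deformation fixes its base point, so the
  -- product homotopy preserves the collapsed points and descends to `M`; the cutoff function uses
  -- the coordinate `j` only.
  choose H v H0 Hpt vpt H1 using fun i => (hX i).exists_homotopy
  obtain ⟨K, hK⟩ := exists_pi_homotopy H
  have hKc : ∀ x t, IsCollapsed S R x → IsCollapsed S R (K (x, t)) := by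
    rintro x t (⟨l, hl, hx⟩ | hx)
    · exact Or.inl ⟨l, hl, by rw [hK, hx, Hpt]⟩
    · exact Or.inr fun l hl => by rw [hK, hx l hl, Hpt]
  obtain ⟨G, hG⟩ := exists_homotopy_desc h.isQuotientMap (π.toMap.comp K) fun x y t hxy => by
    refine (h.eq_iff _ _).2 (((h.eq_iff x y).1 hxy).imp (fun h l hl => ?_)
      (And.imp (hKc x t) (hKc y t)))
    rw [hK, hK, h l hl]
  replace hG : ∀ x t, G (π x, t) = π (K (x, t)) := hG
  refine ⟨p, i, q, ⟨fun b => ?_, fun b => ?_, ?_, fun x y hxy => ?_, ?_⟩, hp, hq⟩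
  · obtain ⟨x, rfl⟩ := hB.isQuotientMap.surjective b
    rw [hi, hp, hB.eq_iff]
    exact Or.inl fun l hl => eraseCoord_ne (Finset.ne_of_mem_erase hl) x
  · obtain ⟨x, rfl⟩ := hB.isQuotientMap.surjective b
    rw [hi, hq, hQ.eq_pt]
    exact Or.inl ⟨j, Finset.mem_insert_self _ _, eraseCoord_self j x⟩
  · refine IsQuotientMap.of_comp π.toMap.continuous q.toMap.continuous ?_
    rw [show (q : M → Q) ∘ π = πQ from funext hq]
    exact hQ.isQuotientMap
  · obtain ⟨x, rfl⟩ := h.isQuotientMap.surjective x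
    obtain ⟨y, rfl⟩ := h.isQuotientMap.surjective y
    rw [hq, hq, hQ.eq_iff] at hxy
    exact hxy.imp (fun h' => (h.eq_iff x y).2 (Or.inl h')) (And.imp (hcol x) (hcol y))
  -- The space `P` is the full product, since `v j` need not descend to `M`: points with a trivial
  -- coordinate in `S` all become the base point of `M`, whatever their `j`-th coordinate.
  · refine ⟨BasedSpace.pi X, inferInstance, π.toMap,
      (v j).comp (BasedSpace.piProj X j).toMap, G, h.isQuotientMap, fun x y hxy => ?_, fun x => ?_,
      fun t => ?_, fun b t => ?_, fun x hx => ?_, fun x hx => ?_⟩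
    · exact ((h.eq_iff x y).1 hxy).imp (fun h' => congrArg (v j) (h' j hj)) fun h' => h.eq_pt h'.1
    · obtain ⟨x, rfl⟩ := h.isQuotientMap.surjective x
      rw [hG]
      exact congrArg π (BasedSpace.pi_ext fun l => by rw [hK, H0])
    · rw [← π.map_pt, hG]
      exact congrArg π (BasedSpace.pi_ext fun l => by
        rw [hK, (BasedSpace.piProj X l).map_pt, Hpt])
    · obtain ⟨x, rfl⟩ := hB.isQuotientMap.surjective b
      rw [hi, hG, hip, herase]
      rw [hK, eraseCoord_self, Hpt]
    · change i (p (G (π x, 1))) = G (π x, 1)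
      rw [hG, hip, herase]
      rw [hK]
      exact H1 j _ hx
    · replace hx : i (p (π x)) = π x := hx
      rw [hip] at hx
      refine ((h.eq_iff _ _).1 hx).imp (fun h' => ?_) fun h' => h.eq_pt h'.2
      change v j (BasedSpace.piProj X j x) = 0
      rw [← h' j hj, eraseCoord_self, vpt]

/-! ### Functoriality of suspension spectra -/

theorem BasedMap.suspIter_comp {X Y Z : BasedSpace.{u}} (g : BasedMap Y Z) (f : BasedMap X Y)
    (n : ℕ) : (g.comp f).suspIter n = (g.suspIter n).comp (f.suspIter n) := by
  induction n with
  | zero => rfl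
  | succ n ih =>
    refine BasedMap.ext fun z => ?_
    obtain ⟨⟨x, t⟩, rfl⟩ := (X.suspIter n).isQuotientMap_suspMk.surjective z
    change (Z.suspIter n).suspMk ((g.comp f).suspIter n x, t) = _
    rw [ih]
    rfl

theorem BasedMap.suspIter_id (X : BasedSpace.{u}) (n : ℕ) :
    (BasedMap.id X).suspIter n = BasedMap.id (X.suspIter n) := by
  induction n with
  | zero => rfl
  | succ n ih =>
    refine BasedMap.ext fun z => ?_
    obtain ⟨⟨x, t⟩, rfl⟩ := (X.suspIter n).isQuotientMap_suspMk.surjective z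
    change (X.suspIter n).suspMk ((BasedMap.id X).suspIter n x, t) = _
    rw [ih]
    rfl

theorem suspensionSpectrumMap_comp_apply {X Y Z : BasedSpace.{u}} (g : BasedMap Y Z)
    (f : BasedMap X Y) (k : ℤ) (α : (suspensionSpectrum X).StableHomotopy k) :
    (suspensionSpectrumMap g).stableHomotopyMap k
        ((suspensionSpectrumMap f).stableHomotopyMap k α) =
      (suspensionSpectrumMap (g.comp f)).stableHomotopyMap k α := by
  rw [← Prespectrum.Hom.stableHomotopyMap_comp]
  congr 1
  exact Prespectrum.Hom.ext fun n x =>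
    (congrArg (fun h : BasedMap _ _ => h x) (BasedMap.suspIter_comp g f n)).symm

theorem suspensionSpectrumMap_id_apply {X : BasedSpace.{u}} {f : BasedMap X X} (hf : ∀ x, f x = x)
    (k : ℤ) (α : (suspensionSpectrum X).StableHomotopy k) :
    (suspensionSpectrumMap f).stableHomotopyMap k α = α := by
  obtain rfl : f = BasedMap.id X := BasedMap.ext hf
  induction α using Quot.inductionOn with
  | h a =>
    refine congrArg (Quot.mk _) ?_
    obtain ⟨m, n, h, c⟩ := a
    simp only [suspensionSpectrumMap, BasedMap.suspIter_id]
    exact congrArg (Prespectrum.StableRep.mk m n h) (homotopyGroupMap_id _ m c)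

/-- The stable homotopy groups of a point are trivial. -/
theorem suspensionSpectrum_stableHomotopy_of_point {X : BasedSpace.{u}} (hX : ∀ x, x = X.pt)
    (k : ℤ) : Subsingleton ((suspensionSpectrum X).StableHomotopy k) ∧
      Nonempty ((suspensionSpectrum X).StableHomotopy k) := by
  have hn : ∀ n (x : X.suspIter n), x = (X.suspIter n).pt := by
    intro n
    induction n with
    | zero => exact hX
    | succ n ih =>
      intro z
      obtain ⟨⟨x, t⟩, rfl⟩ := (X.suspIter n).isQuotientMap_suspMk.surjective z
      rw [ih x]
      exact (X.suspIter n).suspMk_pt t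
  -- Joint bijectivity of the empty family says that the stable homotopy is a singleton.
  have h : JointlyBijective (E := suspensionSpectrum X) (F := fun _ : Empty => suspensionSpectrum X)
      (fun i => i.elim) := by
    refine jointlyBijective_of_stabilize _ (fun m n c c' _ => congrArg _ ?_) fun m n _ =>
      ⟨default, fun i => i.elim⟩
    obtain ⟨c, rfl⟩ := Quotient.exists_rep c
    obtain ⟨c', rfl⟩ := Quotient.exists_rep c'
    exact congrArg homotopyClass (GenLoop.ext _ _ fun t => (hn n _).trans (hn n _).symm)
  exact ⟨⟨fun α β => (h k).1 (funext fun i => i.elim)⟩, ⟨((h k).2 fun i => i.elim).choose⟩⟩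

/-- The stable homotopy groups of a partial smash product, in which the coordinates in `S` are
smashed and those in `R \ S` are not, are the products of those of the smash products over the
sets between `S` and `R`. -/
theorem IsPartialSmash.bijective [DecidableEq ι] (hX : ∀ i, (X i).WellBased) {κ : Type}
    {V : κ → Finset ι} (hV : Function.Injective V) (hV' : ∀ T : Finset ι, T.Nonempty → ∃ a, V a = T)
    {N : κ → BasedSpace.{u}} {πN : ∀ a, BasedMap (BasedSpace.pi X) (N a)}
    (hN : ∀ a, IsPartialSmash (V a) (V a) (πN a)) (k : ℤ) {S R : Finset ι} (hSR : S ⊆ R)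
    {M : BasedSpace.{u}} {π : BasedMap (BasedSpace.pi X) M} (h : IsPartialSmash S R π) :
    (∀ α β, (∀ a, S ⊆ V a → V a ⊆ R → ∀ g : BasedMap M (N a), (∀ x, g (π x) = πN a x) →
        (suspensionSpectrumMap g).stableHomotopyMap k α =
          (suspensionSpectrumMap g).stableHomotopyMap k β) → α = β) ∧
    ∀ γ : ∀ a, (suspensionSpectrum (N a)).StableHomotopy k, ∃ α, ∀ a, S ⊆ V a → V a ⊆ R →
      ∀ g : BasedMap M (N a), (∀ x, g (π x) = πN a x) →
        (suspensionSpectrumMap g).stableHomotopyMap k α = γ a := by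
  induction hn : (R \ S).card generalizing S R M with
  | zero =>
    -- When `S = R`, the space `M` and the chosen smash product are quotients of the product by the
    -- same relation, hence isomorphic as based spaces.
    obtain rfl : S = R := hSR.antisymm
      (Finset.sdiff_eq_empty_iff_subset.1 (Finset.card_eq_zero.1 hn))
    by_cases hS : ∃ a, V a = S
    · obtain ⟨a, rfl⟩ := hS
      obtain ⟨g, hg⟩ := π.exists_desc h.isQuotientMap (πN a) fun x y hxy =>
        ((hN a).eq_iff x y).2 ((h.eq_iff x y).1 hxy)
      obtain ⟨g', hg'⟩ := (πN a).exists_desc (hN a).isQuotientMap π fun x y hxy =>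
        (h.eq_iff x y).2 (((hN a).eq_iff x y).1 hxy)
      have hgg' : ∀ z, g'.comp g z = z := fun z => by
        obtain ⟨x, rfl⟩ := h.isQuotientMap.surjective z
        exact (congrArg g' (hg x)).trans (hg' x)
      refine ⟨fun α β hαβ => ?_,
        fun γ => ⟨(suspensionSpectrumMap g').stableHomotopyMap k (γ a), ?_⟩⟩
      · have := congrArg ((suspensionSpectrumMap g').stableHomotopyMap k)
          (hαβ a subset_rfl subset_rfl g hg)
        rwa [suspensionSpectrumMap_comp_apply, suspensionSpectrumMap_comp_apply,
          suspensionSpectrumMap_id_apply hgg', suspensionSpectrumMap_id_apply hgg'] at this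
      · intro b hb hb' f hf
        obtain rfl : b = a := hV (hb'.antisymm hb)
        rw [suspensionSpectrumMap_comp_apply, suspensionSpectrumMap_id_apply]
        intro z
        obtain ⟨x, rfl⟩ := (hN b).isQuotientMap.surjective z
        exact (congrArg f (hg' x)).trans (hf x)
    -- The family `V` reaches every nonempty set, so only the empty set can be missed; then `M` is a
    -- point and contributes nothing.
    · obtain rfl : S = ∅ := Finset.not_nonempty_iff_eq_empty.1 fun h => hS (hV' S h)
      have hM : ∀ z, z = M.pt := fun z => by
        obtain ⟨x, rfl⟩ := h.isQuotientMap.surjective z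
        exact h.eq_pt (Or.inr fun i hi => absurd hi (Finset.notMem_empty i))
      obtain ⟨h1, ⟨α⟩⟩ := suspensionSpectrum_stableHomotopy_of_point hM k
      exact ⟨fun α β _ => Subsingleton.elim α β, fun γ => ⟨α, fun a ha ha' =>
        absurd ⟨a, ha'.antisymm ha⟩ hS⟩⟩
  | succ n ih =>
    -- The sets between `S` and `R` that avoid `j` belong to the retract `B`, and those that contain
    -- `j` belong to the quotient `Q`. In both cases the interval of sets shrinks by one element.
    obtain ⟨j, hj⟩ : (R \ S).Nonempty := Finset.card_pos.1 (by lia)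
    obtain ⟨hjR, hjS⟩ := Finset.mem_sdiff.1 hj
    have hSB : S ⊆ R.erase j := fun i hi =>
      Finset.mem_erase.2 ⟨ne_of_mem_of_not_mem hi hjS, hSR hi⟩
    have hSQ : insert j S ⊆ R := Finset.insert_subset hjR hSR
    obtain ⟨B, πB, hB⟩ := exists_isPartialSmash (X := X) hSB
    obtain ⟨Q, πQ, hQ⟩ := exists_isPartialSmash (X := X) hSQ
    obtain ⟨p, i, q, hpq, hp, hq⟩ := h.exists_isSplitCollapse hX hjR hjS hB hQ
    obtain ⟨inj, surj⟩ := hpq.bijective k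
    have hnB : (R.erase j \ S).card = n := by
      rw [Finset.erase_sdiff_comm, Finset.card_erase_of_mem hj, hn, Nat.add_sub_cancel]
    have hnQ : (R \ insert j S).card = n := by
      rw [Finset.sdiff_insert, Finset.card_erase_of_mem hj, hn, Nat.add_sub_cancel]
    obtain ⟨injB, surjB⟩ := ih hSB hB hnB
    obtain ⟨injQ, surjQ⟩ := ih hSQ hQ hnQ
    refine ⟨fun α β hαβ => inj α β (injB _ _ fun a ha ha' g hg => ?_)
      (injQ _ _ fun a ha ha' g hg => ?_), fun γ => ?_⟩
    · rw [suspensionSpectrumMap_comp_apply, suspensionSpectrumMap_comp_apply]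
      exact hαβ a ha (ha'.trans (Finset.erase_subset j R)) _ fun x =>
        (congrArg g (hp x)).trans (hg x)
    · rw [suspensionSpectrumMap_comp_apply, suspensionSpectrumMap_comp_apply]
      exact hαβ a ((Finset.subset_insert j S).trans ha) ha' _ fun x =>
        (congrArg g (hq x)).trans (hg x)
    · obtain ⟨b, hb⟩ := surjB γ
      obtain ⟨d, hd⟩ := surjQ γ
      obtain ⟨α, rfl, rfl⟩ := surj b d
      refine ⟨α, fun a ha ha' g hg => ?_⟩
      -- A map out of `M` is determined by its composite with the surjection `π`, so the given `g`
      -- must be the one factoring through `B` or `Q`.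
      have hgM : ∀ {Z : BasedSpace.{u}} {r : BasedMap M Z} {πZ : BasedMap (BasedSpace.pi X) Z}
          {f : BasedMap Z (N a)}, (∀ x, r (π x) = πZ x) → (∀ x, f (πZ x) = πN a x) →
          f.comp r = g := fun {Z r πZ f} hr hf => BasedMap.ext fun z => by
        obtain ⟨x, rfl⟩ := h.isQuotientMap.surjective z
        exact (congrArg f (hr x)).trans ((hf x).trans (hg x).symm)
      by_cases hja : j ∈ V a
      · have hVa := Finset.insert_subset hja ha
        obtain ⟨f, hf⟩ := πQ.exists_desc hQ.isQuotientMap (πN a) fun x y hxy =>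
          (((hN a).eq_iff x y).2 (((hQ.eq_iff x y).1 hxy).imp (fun h i hi => h i (ha' hi))
            (And.imp (IsCollapsed.mono hVa ha' x) (IsCollapsed.mono hVa ha' y))))
        have := hd a hVa ha' f hf
        rwa [suspensionSpectrumMap_comp_apply, hgM hq hf] at this
      · have hVa : V a ⊆ R.erase j := fun l hl =>
          Finset.mem_erase.2 ⟨ne_of_mem_of_not_mem hl hja, ha' hl⟩
        obtain ⟨f, hf⟩ := πB.exists_desc hB.isQuotientMap (πN a) fun x y hxy =>
          (((hN a).eq_iff x y).2 (((hB.eq_iff x y).1 hxy).imp (fun h i hi => h i (hVa hi))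
            (And.imp (IsCollapsed.mono ha hVa x) (IsCollapsed.mono ha hVa y))))
        have := hb a ha hVa f hf
        rwa [suspensionSpectrumMap_comp_apply, hgM hp hf] at this

end PartialSmash

/-! ## Finite wedges and products of prespectra -/

section Wedge

variable {ι : Type} [DecidableEq ι]

/-- The projection of a wedge to one of its summands. -/
def BasedSpace.wedgeProj (X : ι → BasedSpace.{u}) (i : ι) : BasedMap (BasedSpace.wedge X) (X i) :=
  BasedSpace.wedgeDesc fun j =>
    if h : j = i then h ▸ BasedMap.id (X j) else BasedMap.const (X j) (X i)

theorem BasedSpace.wedgeProj_incl (X : ι → BasedSpace.{u}) (i : ι) (x : X i) :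
    BasedSpace.wedgeProj X i (BasedSpace.wedgeIncl X i x) = x := by
  change (if h : i = i then h ▸ BasedMap.id (X i) else BasedMap.const (X i) (X i) :
    BasedMap (X i) (X i)) x = x
  rw [dif_pos rfl]
  rfl

theorem BasedSpace.wedgeProj_incl_ne (X : ι → BasedSpace.{u}) {i j : ι} (h : j ≠ i) (x : X j) :
    BasedSpace.wedgeProj X i (BasedSpace.wedgeIncl X j x) = (X i).pt := by
  change (if h : j = i then h ▸ BasedMap.id (X j) else BasedMap.const (X j) (X i) :
    BasedMap (X j) (X i)) x = _
  rw [dif_neg h]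
  rfl

def Prespectrum.wedgeProj (E : ι → Prespectrum.{u}) (i : ι) :
    Prespectrum.Hom (Prespectrum.wedge E) (E i) where
  map n := BasedSpace.wedgeProj (fun i => (E i).level n) i
  comm n z := by
    let Y := fun i => (E i).level n
    let Y' := fun i => (E i).level (n + 1)
    obtain ⟨⟨w, t⟩, rfl⟩ := (BasedSpace.wedge Y).isQuotientMap_suspMk.surjective z
    rcases BasedSpace.wedge_cases w with rfl | ⟨j, x, rfl⟩
    · have h := (BasedSpace.wedge Y).suspMk_pt t
      refine ((congrArg _ ((congrArg _ h).trans ((Prespectrum.wedge E).str n).map_pt)).trans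
        (BasedSpace.wedgeProj Y' i).map_pt).trans ?_
      exact ((congrArg _ ((congrArg _ h).trans (BasedSpace.wedgeProj Y i).susp.map_pt)).trans
        ((E i).str n).map_pt).symm
    · have h : (Prespectrum.wedge E).str n ((BasedSpace.wedge Y).suspMk
          (BasedSpace.wedgeIncl Y j x, t)) =
          BasedSpace.wedgeIncl Y' j ((E j).str n ((Y j).suspMk (x, t))) := rfl
      have h' : (BasedSpace.wedgeProj Y i).susp ((BasedSpace.wedge Y).suspMk
          (BasedSpace.wedgeIncl Y j x, t)) =
          (Y i).suspMk (BasedSpace.wedgeProj Y i (BasedSpace.wedgeIncl Y j x), t) := rfl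
      refine (congrArg (BasedSpace.wedgeProj Y' i) h).trans
        (Eq.trans ?_ (congrArg ((E i).str n) h').symm)
      by_cases hij : j = i
      · subst hij
        rw [BasedSpace.wedgeProj_incl, BasedSpace.wedgeProj_incl]
      · rw [BasedSpace.wedgeProj_incl_ne _ hij, BasedSpace.wedgeProj_incl_ne _ hij,
          (Y i).suspMk_pt]
        exact ((E i).str n).map_pt.symm

/-- A suspended element of a homotopy group of a finite wedge is determined by its projections. -/
theorem homotopyGroupSusp_wedge_ext [Fintype ι] (X : ι → BasedSpace.{u}) (m : ℕ)
    {c c' : HomotopyGroup.Pi m (BasedSpace.wedge X) (BasedSpace.wedge X).pt}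
    (h : ∀ i, homotopyGroupMap (BasedSpace.wedgeProj X i) m c =
      homotopyGroupMap (BasedSpace.wedgeProj X i) m c') :
    homotopyGroupSusp _ m c = homotopyGroupSusp _ m c' := by
  let W := BasedSpace.wedge X
  -- `e T` collapses the summands outside `T`, and `r j` keeps only the summand `j`. Adding one
  -- summand at a time leads from the constant map `e ∅` to the identity `e univ`.
  let e : Finset ι → BasedMap W W := fun T => BasedSpace.wedgeDesc fun i =>
    if i ∈ T then BasedSpace.wedgeIncl X i else BasedMap.const (X i) W
  let r : ι → BasedMap W W := fun i => (BasedSpace.wedgeIncl X i).comp (BasedSpace.wedgeProj X i)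
  have he : ∀ T i x, e T (BasedSpace.wedgeIncl X i x) =
      if i ∈ T then BasedSpace.wedgeIncl X i x else W.pt := fun T i x =>
    apply_ite (fun f : BasedMap (X i) W => f x) _ _ _
  have hr : ∀ j i x, r j (BasedSpace.wedgeIncl X i x) =
      if i = j then BasedSpace.wedgeIncl X i x else W.pt := fun j i x => by
    change BasedSpace.wedgeIncl X j (BasedSpace.wedgeProj X j (BasedSpace.wedgeIncl X i x)) = _
    split_ifs with hij
    · subst hij
      rw [BasedSpace.wedgeProj_incl]
    · rw [BasedSpace.wedgeProj_incl_ne X hij]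
      exact (BasedSpace.wedgeIncl X j).map_pt
  have hinsert : ∀ (T : Finset ι) j, j ∉ T → ∀ c : HomotopyGroup.Pi m W W.pt,
      homotopyGroupSusp W m (homotopyGroupMap (e (insert j T)) m c) =
        homotopyGroupSusp W m (homotopyGroupMap (r j) m c) *
          homotopyGroupSusp W m (homotopyGroupMap (e T) m c) := by
    intro T j hj c
    obtain ⟨a, rfl⟩ : ∃ a, homotopyClass a = c := Quotient.exists_rep c
    -- Since `j ∉ T`, no point of the wedge is moved off the base point by both `e T` and `r j`, so
    -- the suspended loops multiply to the suspension of their union.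
    refine (homotopyGroup_mul_susp_of_disjoint W (genLoopMap (e T) a) (genLoopMap (r j) a)
      (genLoopMap (e (insert j T)) a) fun y => ?_).symm
    change (e (insert j T) (a.1 y) = e T (a.1 y) ∧ r j (a.1 y) = W.pt) ∨
      (e (insert j T) (a.1 y) = r j (a.1 y) ∧ e T (a.1 y) = W.pt)
    rcases BasedSpace.wedge_cases (a.1 y) with h | ⟨i, x, h⟩
    · rw [h]
      exact Or.inl ⟨(e (insert j T)).map_pt.trans (e T).map_pt.symm, (r j).map_pt⟩
    · rw [h, he, he, hr]
      by_cases hij : i = j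
      · subst hij
        simp [hj]
      · simp [hij]
  have key : ∀ T : Finset ι, homotopyGroupSusp W m (homotopyGroupMap (e T) m c) =
      homotopyGroupSusp W m (homotopyGroupMap (e T) m c') := by
    intro T
    induction T using Finset.induction_on with
    | empty =>
      have h0 : ∀ w, e ∅ w = W.pt := fun w => by
        rcases BasedSpace.wedge_cases w with rfl | ⟨i, x, rfl⟩
        · exact (e ∅).map_pt
        · rw [he, if_neg (Finset.notMem_empty i)]
      obtain ⟨a, rfl⟩ : ∃ a, homotopyClass a = c := Quotient.exists_rep c
      obtain ⟨a', rfl⟩ : ∃ a, homotopyClass a = c' := Quotient.exists_rep c'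
      exact congrArg (fun b => homotopyGroupSusp W m (homotopyClass b))
        (GenLoop.ext (genLoopMap (e ∅) a) (genLoopMap (e ∅) a') fun y =>
          (h0 _).trans (h0 _).symm)
    | insert j T hj ih =>
      rw [hinsert T j hj, hinsert T j hj, ih, homotopyGroupMap_comp, homotopyGroupMap_comp, h j]
  have hid : e Finset.univ = BasedMap.id W := BasedMap.ext fun w => by
    rcases BasedSpace.wedge_cases w with rfl | ⟨i, x, rfl⟩
    · exact (e _).map_pt
    · rw [he, if_pos (Finset.mem_univ i)]
      rfl
  have := key Finset.univ
  rwa [hid, homotopyGroupMap_id, homotopyGroupMap_id] at this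

/-- No condition on base points is needed. Injectivity is the decomposition of suspended classes,
and surjectivity multiplies the images of the given classes under the inclusions of the summands. -/
theorem jointlyBijective_wedgeProj [Fintype ι] (E : ι → Prespectrum.{u}) :
    JointlyBijective (Prespectrum.wedgeProj E) := by
  refine jointlyBijective_of_stabilize _ (fun m n c c' hc => ?_) fun m n b => ?_
  · exact congrArg (homotopyGroupMap _ _)
      (homotopyGroupSusp_wedge_ext (fun i => (E i).level n) m hc)
  · let Y := fun i => (E i).level (n + 1)
    let d : ∀ i, HomotopyGroup.Pi (m + 1) (Y i) (Y i).pt := fun i => (E i).stabilize m n (b i)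
    have key : ∀ T : Finset ι, ∃ c : HomotopyGroup.Pi (m + 1) (BasedSpace.wedge Y)
        (BasedSpace.wedge Y).pt, ∀ i,
        homotopyGroupMap (BasedSpace.wedgeProj Y i) (m + 1) c = if i ∈ T then d i else 1 := by
      intro T
      induction T using Finset.induction_on with
      | empty => exact ⟨1, fun i => homotopyGroupMap_one _ _⟩
      | insert j T hj ih =>
        obtain ⟨c, hc⟩ := ih
        refine ⟨c * homotopyGroupMap (BasedSpace.wedgeIncl Y j) (m + 1) (d j), fun i => ?_⟩
        rw [homotopyGroupMap_mul, hc, ← homotopyGroupMap_comp]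
        by_cases hij : j = i
        · subst hij
          have hid : (BasedSpace.wedgeProj Y j).comp (BasedSpace.wedgeIncl Y j) = BasedMap.id _ :=
            BasedMap.ext (BasedSpace.wedgeProj_incl Y j)
          rw [hid, homotopyGroupMap_id, if_neg hj, if_pos (Finset.mem_insert_self j T), one_mul]
        · have h0 : ∀ x, (BasedSpace.wedgeProj Y i).comp (BasedSpace.wedgeIncl Y j) x = (Y i).pt :=
            BasedSpace.wedgeProj_incl_ne Y hij
          rw [homotopyGroupMap_eq_one h0, mul_one]
          simp [Finset.mem_insert, Ne.symm hij]
    obtain ⟨c, hc⟩ := key Finset.univ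
    exact ⟨c, fun i => (hc i).trans (if_pos (Finset.mem_univ i))⟩

/-- The canonical map from a finite wedge of prespectra to the product is a stable equivalence. -/
theorem isStableEquivalence_wedge_pi [Fintype ι] (E : ι → Prespectrum.{u}) :
    (Prespectrum.piLift (Prespectrum.wedgeProj E)).IsStableEquivalence :=
  (isLevelProduct_pi E).isStableEquivalence _ _ (jointlyBijective_wedgeProj E) fun _ _ _ => rfl

end Wedge

/-! ## The splitting -/

section Splitting

variable {ι : Type} {X : ι → BasedSpace.{u}}

/-- For `S = ∅` only the base point is collapsed. Allowing any injective quotient map, instead of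
the identity alone, covers the binary product as well. -/
theorem isPartialSmash_empty_univ [Fintype ι] {M : BasedSpace.{u}}
    {π : BasedMap (BasedSpace.pi X) M} (hq : IsQuotientMap π) (hπ : Function.Injective π) :
    IsPartialSmash ∅ Finset.univ π := by
  refine ⟨hq, fun x y => ⟨fun h => Or.inl fun i _ => ?_, ?_⟩⟩
  · rw [hπ h]
  · rintro (h | ⟨hx | hx, hy | hy⟩)
    · exact congrArg π (BasedSpace.pi_ext fun i => h i (Finset.mem_univ i))
    · exact absurd hx (by simp)
    · exact absurd hx (by simp)
    · exact absurd hy (by simp)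
    · exact congrArg π (BasedSpace.pi_ext fun i =>
        (hx i (Finset.mem_univ i)).trans (hy i (Finset.mem_univ i)).symm)

theorem isCollapsed_self_iff {T : Finset ι} (hT : T.Nonempty) (x : BasedSpace.pi X) :
    IsCollapsed T T x ↔ ∃ i ∈ T, BasedSpace.piProj X i x = (X i).pt := by
  refine ⟨?_, Or.inl⟩
  rintro (h | h)
  · exact h
  · exact ⟨_, hT.choose_spec, h _ hT.choose_spec⟩

/-- The projection from the product to the smash product of a reindexed subfamily. -/
def toReindexedSmash {J : Type} [Finite J] [Nonempty J] (X : ι → BasedSpace.{u}) (f : J → ι) :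
    BasedMap (BasedSpace.pi X) (BasedSpace.smash fun j => X (f j)) :=
  (BasedSpace.toSmash fun j => X (f j)).comp
    (BasedSpace.piLift fun j => BasedSpace.piProj X (f j))

/-- The index type `J` is kept free because smash products occur indexed both by a subset `S` itself
and by `Fin (j + 1)`. Injectivity of `f` provides a section of the projection to the subfamily. -/
theorem isPartialSmash_toReindexedSmash {J : Type} [Finite J] [Nonempty J] {f : J → ι}
    (hf : Function.Injective f) {T : Finset ι} (hT : ∀ i, i ∈ T ↔ ∃ j, f j = i) :
    IsPartialSmash T T (toReindexedSmash X f) := by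
  classical
  let Y := fun j => X (f j)
  let r : BasedMap (BasedSpace.pi X) (BasedSpace.pi Y) :=
    BasedSpace.piLift fun j => BasedSpace.piProj X (f j)
  let s : BasedMap (BasedSpace.pi Y) (BasedSpace.pi X) := BasedSpace.piLift fun i =>
    if h : ∃ j, f j = i then h.choose_spec ▸ BasedSpace.piProj Y h.choose
    else BasedMap.const (BasedSpace.pi Y) (X i)
  have hrs : ∀ y, r (s y) = y := fun y => BasedSpace.pi_ext fun j => by
    have h : BasedSpace.piProj X (f j) (s y) = (if h : ∃ j', f j' = f j then
      h.choose_spec ▸ BasedSpace.piProj Y h.choose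
      else BasedMap.const (BasedSpace.pi Y) (X (f j)) :
        BasedMap (BasedSpace.pi Y) (X (f j))) y := rfl
    have h' : ∀ j' (e : f j' = f j), (e ▸ BasedSpace.piProj Y j' :
        BasedMap (BasedSpace.pi Y) (X (f j))) y = BasedSpace.piProj Y j y := fun j' e => by
      obtain rfl := hf e
      rfl
    rw [dif_pos ⟨j, rfl⟩, h'] at h
    exact h
  have hne : T.Nonempty := ⟨f (Classical.arbitrary J), (hT _).2 ⟨_, rfl⟩⟩
  have hfat : ∀ x, r x ∈ BasedSpace.fatWedge Y ↔ IsCollapsed T T x := fun x => by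
    rw [isCollapsed_self_iff hne]
    constructor
    · rintro ⟨j, hj⟩
      exact ⟨f j, (hT _).2 ⟨j, rfl⟩, hj⟩
    · rintro ⟨i, hi, hx⟩
      obtain ⟨j, rfl⟩ := (hT i).1 hi
      exact ⟨j, hx⟩
  refine ⟨IsQuotientMap.comp (g := BasedSpace.toSmash Y)
    (isQuotientMap_quotient_mk' (s := collapseSetoid (BasedSpace.fatWedge Y)))
    (isQuotientMap_of_section r s hrs), fun x y => ?_⟩
  refine (Collapse.mk_eq_iff (A := BasedSpace.fatWedge Y) (x := r x) (y := r y)).trans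
    (or_congr ?_ ?_)
  · constructor
    · intro h i hi
      obtain ⟨j, rfl⟩ := (hT i).1 hi
      exact congrArg (BasedSpace.piProj Y j) h
    · exact fun h => BasedSpace.pi_ext fun j => h (f j) ((hT _).2 ⟨j, rfl⟩)
  · rw [hfat, hfat]

/-- The stable splitting of a finite product, for arbitrary models of the product and of the smash
products of the subfamilies. -/
theorem jointlyBijective_of_isPartialSmash [Fintype ι] [DecidableEq ι]
    (hX : ∀ i, (X i).WellBased) {κ : Type} {V : κ → Finset ι} (hV : Function.Injective V)
    (hV' : ∀ T : Finset ι, T.Nonempty → ∃ a, V a = T)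
    {N : κ → BasedSpace.{u}} {πN : ∀ a, BasedMap (BasedSpace.pi X) (N a)}
    (hN : ∀ a, IsPartialSmash (V a) (V a) (πN a)) {M : BasedSpace.{u}}
    {π : BasedMap (BasedSpace.pi X) M} (h : IsPartialSmash ∅ Finset.univ π)
    (g : ∀ a, BasedMap M (N a)) (hg : ∀ a x, g a (π x) = πN a x) :
    JointlyBijective fun a => suspensionSpectrumMap (g a) := by
  intro k
  obtain ⟨inj, surj⟩ := IsPartialSmash.bijective hX hV hV' hN k (Finset.empty_subset _) h
  refine ⟨fun α β hαβ => inj α β fun a _ _ f hf => ?_, fun γ => ?_⟩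
  · obtain rfl : g a = f := BasedMap.ext fun z => by
      obtain ⟨x, rfl⟩ := h.isQuotientMap.surjective z
      exact (hg a x).trans (hf x).symm
    exact congrFun hαβ a
  · obtain ⟨α, hα⟩ := surj γ
    exact ⟨α, funext fun a => hα a (Finset.empty_subset _) (Finset.subset_univ _) (g a) (hg a)⟩

theorem isStableEquivalence_splitting {n : ℕ} (X : Fin n → BasedSpace.{u})
    (hX : ∀ i, (X i).WellBased) : (splitting X).IsStableEquivalence := by
  refine (isLevelProduct_pi _).isStableEquivalence _ _
    (jointlyBijective_of_isPartialSmash (V := fun S : NonemptySubset n => S.1) hX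
      Subtype.val_injective (fun T hT => ⟨⟨T, hT⟩, rfl⟩) (πN := toSubsetSmash X)
      (fun S => isPartialSmash_toReindexedSmash (f := fun i : S.1 => (i : Fin n))
        Subtype.val_injective fun i => by simp)
      (π := BasedMap.id _) (isPartialSmash_empty_univ IsQuotientMap.id fun _ _ h => h)
      (toSubsetSmash X) fun _ _ => rfl) fun _ _ _ => rfl

/-- The subsets of `{1, …, n}` with `j + 1` elements, `0 ≤ j < n`, are enumerated by
`(n choose j + 1)`. -/
theorem exists_subset_enumeration (n : ℕ) :
    ∃ V : (Σ j : Fin n, Fin (n.choose (j + 1))) → Finset (Fin n), Function.Injective V ∧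
      (∀ T : Finset (Fin n), T.Nonempty → ∃ a, V a = T) ∧ ∀ a, (V a).card = a.1 + 1 := by
  have e : ∀ j : Fin n, Nonempty (Fin (n.choose (j + 1)) ≃
      Finset.powersetCard (j + 1 : ℕ) (Finset.univ : Finset (Fin n))) := fun j =>
    ⟨(Finset.equivFinOfCardEq (by simp)).symm⟩
  let f := fun j => (e j).some
  have hc : ∀ a : (Σ j : Fin n, Fin (n.choose (j + 1))), (f a.1 a.2).1.card = a.1 + 1 := fun a =>
    (Finset.mem_powersetCard.1 (f a.1 a.2).2).2
  refine ⟨fun a => (f a.1 a.2).1, fun a b hab => ?_, fun T hT => ?_, hc⟩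
  · obtain ⟨j, c⟩ := a
    obtain ⟨j', c'⟩ := b
    have h := (hc ⟨j, c⟩).symm.trans ((congrArg Finset.card hab).trans (hc ⟨j', c'⟩))
    obtain rfl : j = j' := Fin.ext (Nat.succ_injective h)
    obtain rfl : c = c' := (f j).injective (Subtype.ext hab)
    rfl
  · have h1 := hT.card_pos
    have h2 := T.card_le_univ
    rw [Fintype.card_fin] at h2
    let j : Fin n := ⟨T.card - 1, by lia⟩
    obtain ⟨c, hc⟩ := (f j).surjective ⟨T, Finset.mem_powersetCard.2
      ⟨Finset.subset_univ _, (Nat.sub_add_cancel h1).symm⟩⟩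
    exact ⟨⟨j, c⟩, congrArg Subtype.val hc⟩

theorem stablyEquivalent_binomialWedge (n : ℕ) (X : BasedSpace.{u}) (hX : X.WellBased) :
    Prespectrum.StablyEquivalent (suspensionSpectrum (BasedSpace.pi fun _ : Fin n => X))
      (binomialWedge X n) := by
  obtain ⟨V, hV, hV', hcard⟩ := exists_subset_enumeration n
  -- The increasing enumeration of `V a` identifies the smash product over this set with one over
  -- `Fin (a.1 + 1)`, as used in `binomialWedge`.
  let f : ∀ a : (Σ j : Fin n, Fin (n.choose (j + 1))), Fin (a.1 + 1) → Fin n := fun a =>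
    (V a).orderEmbOfFin (hcard a)
  have hf : ∀ a i, i ∈ V a ↔ ∃ j, f a j = i := fun a i => by
    have := Finset.range_orderEmbOfFin (V a) (hcard a)
    rw [← Finset.mem_coe, ← this]
    rfl
  let N : (Σ j : Fin n, Fin (n.choose (j + 1))) → BasedSpace.{u} := fun a =>
    BasedSpace.smash fun _ : Fin (a.1 + 1) => X
  let g : ∀ a, BasedMap (BasedSpace.pi fun _ : Fin n => X) (N a) := fun a =>
    toReindexedSmash (fun _ => X) (f a)
  have h : JointlyBijective fun a => suspensionSpectrumMap (g a) :=
    jointlyBijective_of_isPartialSmash (fun _ => hX) hV hV' (πN := g)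
      (fun a => isPartialSmash_toReindexedSmash ((V a).orderEmbOfFin (hcard a)).injective (hf a))
      (π := BasedMap.id _) (isPartialSmash_empty_univ IsQuotientMap.id fun _ _ h => h) g
      fun _ _ => rfl
  have h1 : (Prespectrum.piLift fun a => suspensionSpectrumMap (g a)).IsStableEquivalence :=
    (isLevelProduct_pi _).isStableEquivalence _ _ h fun _ _ _ => rfl
  -- Both the suspension spectrum of the power and the wedge map to the product of the
  -- `suspensionSpectrum (N a)`, so the zigzag has two arrows meeting there.
  exact .trans _ _ _ (.rel _ _ ⟨_, h1⟩)
    (.symm _ _ (.rel _ _ ⟨_, isStableEquivalence_wedge_pi fun a => suspensionSpectrum (N a)⟩))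

/-! ### The binary splitting -/

/-- A factor serves as its own one-fold smash product, as required for the targets `X` and `Y` of
the binary splitting map. -/
theorem isPartialSmash_piProj [DecidableEq ι] (i : ι) :
    IsPartialSmash {i} {i} (BasedSpace.piProj X i) := by
  let s : BasedMap (X i) (BasedSpace.pi X) := BasedSpace.piLift fun j =>
    if h : i = j then h ▸ BasedMap.id (X i) else BasedMap.const (X i) (X j)
  refine ⟨isQuotientMap_of_section _ s fun x => ?_, fun x y => ?_⟩
  · change (if h : i = i then h ▸ BasedMap.id (X i) else BasedMap.const (X i) (X i) :
      BasedMap (X i) (X i)) x = x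
    rw [dif_pos rfl]
    rfl
  · rw [isCollapsed_self_iff (Finset.singleton_nonempty i),
      isCollapsed_self_iff (Finset.singleton_nonempty i)]
    simp only [Finset.mem_singleton, forall_eq, exists_eq_left]
    exact ⟨Or.inl, fun h => h.elim id fun h => h.1.trans h.2.symm⟩

theorem isStableEquivalence_binarySplitting (X Y : BasedSpace.{u}) (hX : X.WellBased)
    (hY : Y.WellBased) : (binarySplitting X Y).IsStableEquivalence := by
  let Z : Bool → BasedSpace.{u} := Bool.rec Y X
  let π : BasedMap (BasedSpace.pi Z) (X.prod Y) :=
    BasedSpace.prodLift (BasedSpace.piProj Z true) (BasedSpace.piProj Z false)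
  let s : BasedMap (X.prod Y) (BasedSpace.pi Z) :=
    BasedSpace.piLift (Bool.rec (X.prodSnd Y) (X.prodFst Y))
  have hπ : IsQuotientMap π := isQuotientMap_of_section π s fun _ => rfl
  -- With `true` for `X` and `false` for `Y`, the index `none` is the two-element set, belonging to
  -- `X ∧ Y`, and `some b` is the singleton `{b}`.
  let V : Option Bool → Finset Bool := fun o => o.elim Finset.univ fun b => {b}
  let N : Option Bool → BasedSpace.{u} := fun o => o.elim (X.smash₂ Y) Z
  let g : ∀ o, BasedMap (X.prod Y) (N o) := fun o => match o with
    | none => X.toSmash₂ Y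
    | some true => X.prodFst Y
    | some false => X.prodSnd Y
  have h : JointlyBijective fun a => suspensionSpectrumMap (g a) := by
    refine jointlyBijective_of_isPartialSmash (X := Z) (V := V)
      (Bool.rec hY hX) (by decide) (by decide) (πN := fun o => (g o).comp π) ?_
      (isPartialSmash_empty_univ hπ fun x y hxy => ?_) g fun _ _ => rfl
    · rintro (_ | _ | _)
      · refine ⟨IsQuotientMap.comp (g := X.toSmash₂ Y)
          (isQuotientMap_quotient_mk' (s := collapseSetoid (X.axes Y))) hπ, fun x y => ?_⟩
        refine (Collapse.mk_eq_iff (A := X.axes Y) (x := π x) (y := π y)).trans (or_congr ?_ ?_)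
        · constructor
          · intro h i _
            cases i with
            | false => exact congrArg (X.prodSnd Y) h
            | true => exact congrArg (X.prodFst Y) h
          · exact fun h => Prod.ext (h true (Finset.mem_univ _)) (h false (Finset.mem_univ _))
        · have hax : ∀ x, π x ∈ X.axes Y ↔ IsCollapsed (V none) (V none) x := fun x => by
            refine Iff.trans ?_ (isCollapsed_self_iff Finset.univ_nonempty x).symm
            constructor
            · rintro (h | h)
              exacts [⟨true, Finset.mem_univ _, h⟩, ⟨false, Finset.mem_univ _, h⟩]
            · rintro ⟨_ | _, -, h⟩
              exacts [Or.inr h, Or.inl h]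
          rw [hax, hax]
      · exact isPartialSmash_piProj false
      · exact isPartialSmash_piProj true
    · refine BasedSpace.pi_ext fun i => ?_
      cases i with
      | false => exact congrArg (X.prodSnd Y) hxy
      | true => exact congrArg (X.prodFst Y) hxy
  let E₁ := suspensionSpectrum (X.smash₂ Y)
  let E₂ := suspensionSpectrum X
  let E₃ := suspensionSpectrum Y
  let pr : ∀ o, Prespectrum.Hom (E₁.prod (E₂.prod E₃)) (suspensionSpectrum (N o)) := fun o =>
    match o with
    | none => E₁.prodFst (E₂.prod E₃)
    | some true => (E₂.prodFst E₃).comp (E₁.prodSnd (E₂.prod E₃))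
    | some false => (E₂.prodSnd E₃).comp (E₁.prodSnd (E₂.prod E₃))
  -- The target is an iterated binary product; a map into it is lifted first to the inner product
  -- and then to the outer one.
  have hpr : IsLevelProduct pr := by
    refine ⟨fun n x y hxy => ?_, fun n T _ _ _ f => ?_⟩
    · exact Prod.ext (hxy none) (Prod.ext (hxy (some true)) (hxy (some false)))
    · obtain ⟨a, ha⟩ := exists_lift_kSpace
        (ContinuousMap.prodMk (f (some true)) (f (some false)) : C(T, E₂.level n × E₃.level n))
      obtain ⟨b, hb⟩ := exists_lift_kSpace
        (ContinuousMap.prodMk (f none) a : C(T, E₁.level n × (E₂.prod E₃).level n))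
      refine ⟨b, fun o t => ?_⟩
      have h1 := congrArg Prod.fst (hb t)
      have h2 := congrArg Prod.snd (hb t)
      match o with
      | none => exact h1
      | some true =>
        exact (congrArg (fun z => (KSpace.val z).1) h2).trans (congrArg Prod.fst (ha t))
      | some false =>
        exact (congrArg (fun z => (KSpace.val z).2) h2).trans (congrArg Prod.snd (ha t))
  refine hpr.isStableEquivalence _ _ h fun o n x => ?_
  match o with
  | none => rfl
  | some true => rfl
  | some false => rfl

end Splitting

end StableSplitting

theorem mainTheorem7 :
    (∀ X Y : BasedSpace.{u}, X.WellBased → Y.WellBased →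
      (binarySplitting X Y).IsStableEquivalence) ∧
    (∀ (n : ℕ) (X : Fin n → BasedSpace.{u}), (∀ i, (X i).WellBased) →
      (splitting X).IsStableEquivalence) ∧
    (∀ (n : ℕ) (X : BasedSpace.{u}), X.WellBased →
      Prespectrum.StablyEquivalent (suspensionSpectrum (BasedSpace.pi fun _ : Fin n => X))
        (binomialWedge X n)) :=
  ⟨isStableEquivalence_binarySplitting, fun _ => isStableEquivalence_splitting,
    stablyEquivalent_binomialWedge⟩
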